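/- **Setting.** Inner products $(\cdot,\cdot)$ are linear in the first argument. Let $A_0$ be a nonnegative self-adjoint operator in a complex Hilbert space $\mathfrak H$. Put $\mathfrak H_1=\mathcal D(A_0^{1/2})=\mathcal D((A_0+I)^{1/2})$, and let $\mathfrak H\subset\mathfrak H_{-1}\subset\mathfrak H_{-2}$ be the completions of $\mathfrak H$ in the norms $\|(A_0+I)^{-k/2}u\|$, $k=1,2$. Let $(\mathbb A_0+I)^{-1}:\mathfrak H_{-2}\to\mathfrak H$ be the isometric extension of $(A_0+I)^{-1}$, and put $\langle\psi,u\rangle=((A_0+I)u,(\mathbb A_0+I)^{-1}\psi)$ for $\psi\in\mathfrak H_{-2}$, $u\in\mathcal D(A_0)$. Let $\psi_1,\dots,\psi_n\in\mathfrak H_{-2}$ be linearly independent with $\operatorname{span}\{\psi_j\}\cap\mathfrak H=\{0\}$, let $h_j=(\mathbb A_0+I)^{-1}\psi_j$, and let $A_{\rm sym}$ be the restriction of $A_0$ to $\{u\in\mathcal D(A_0):\langle\psi_j,u\rangle=0,\ 1\le j\le n\}$, a closed densely defined nonnegative symmetric operator. Let $A_F$ and $A_N$ be its Friedrichs and Krein–von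 Neumann extensions. Put $\mathcal H=\ker(A_{\rm sym}^*+I)$, which has basis $h_1,\dots,h_n$, so that $\mathcal D(A_{\rm sym}^*)=\mathcal D(A_0)\dotplus\mathcal H$; put $\mathcal H'=\mathcal H\cap\mathfrak H_1$ and $\mathcal H''=\mathcal H\ominus\mathcal H'$. Extensions $B_1,B_2$ of $A_{\rm sym}$ contained in $A_{\rm sym}^*$ are *transversal* if $\mathcal D(B_1)+\mathcal D(B_2)=\mathcal D(A_{\rm sym}^*)$. **Admissible operators.** For a Hermitian matrix $\mathbf R=(r_{jp})_{j,p=1}^n$ put $\langle\psi_j^{\rm ex},f\rangle=\langle\psi_j,u\rangle+\sum_p\alpha_p r_{jp}$ for $f=u+\sum_p\alpha_p h_p$, $u\in\mathcal D(A_0)$, $\alpha_p\in\mathbb C$. The matrix $\mathbf R$ is *admissible* if, whenever $\psi=\sum_j c_j\psi_j\in\mathfrak H_{-1}$ and $h=(\mathbb A_0+I)^{-1}\psi$, one has $\sum_j\overline{c_j}\,\langle\psi_j^{\rm ex},f\rangle=((A_0+I)^{1/2}f,(A_0+I)^{1/2}h)$ for all $f\in\mathcal D(A_{\rm sym}^*)\cap\mathfrak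 H_1$. An operator is *admissible* if, for some admissible $\mathbf R$, it is the restriction of $A_{\rm sym}^*$ to $\{f\in\mathcal D(A_{\rm sym}^*):\langle\psi_j^{\rm ex},f\rangle=0,\ 1\le j\le n\}$. **Symmetry.** Let $\mathfrak T\subset\mathbb R$ and let $\mathfrak U=\{U_t\}_{t\in\mathfrak T}$ be unitary operators on $\mathfrak H$ with $U\in\mathfrak U\iff U^*\in\mathfrak U$. Given a function $p:\mathfrak T\to\mathbb R$, an operator $A\neq0$ is *$p(t)$-homogeneous* if $U_tA=p(t)AU_t$ (domains included) for all $t\in\mathfrak T$. Assume that $A_0$ is $p(t)$-homogeneous and that, for real functions $\xi_1,\dots,\xi_n$ on $\mathfrak T$, $\mathbb U_t\psi_j=\xi_j(t)\psi_j$ for all $t\in\mathfrak T$ and all $j$, where $\mathbb U_t$ is the continuous extension of $U_t$ to $\mathfrak H_{-2}$. Put $\beta_{ij}(t)=\xi_i(t)-p(t)/\xi_j(t)$. **Theorem.** Assume that 1. $A_F$ and $A_N$ are transversal; 2. $\widetilde{\mathcal H}\subset\mathcal H$ is a subspace with $\dim\widetilde{\mathcal H}=\dim\mathcal H'$ and $\widetilde{\mathcal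 H}\cap\mathcal H''=\{0\}$ such that the restriction $S$ of $A_F$ to $\mathcal D(S)=(A_F+I)^{-1}[\mathcal R(A_{\rm sym}+I)\oplus\widetilde{\mathcal H}]$ is $p(t)$-homogeneous; 3. for all $1\le i,j\le n$ there is $t_{ij}\in\mathfrak T$ with $\beta_{ij}(t_{ij})\ne0$. Then there exists exactly one $p(t)$-homogeneous admissible operator, and it is the Krein–von Neumann extension of $S$. -/

import Mathlib

open Filter Topology

namespace SingPert

universe u

variable {H : Type u} [NormedAddCommGroup H] [InnerProductSpace ℂ H]

/-! ### Nonnegative operators and the shifted operator `A + I` -/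

/-- `(A x, x) ≥ 0` on the domain of `A`. (All operators below to which this is applied are
symmetric, so that `(A x, x)` is real.) -/
def IsNonneg (A : H →ₗ.[ℂ] H) : Prop :=
  ∀ x : A.domain, 0 ≤ (inner ℂ (x : H) (A x)).re

/-- The map `u ↦ A u + u` on the domain of `A`. -/
def shift (A : H →ₗ.[ℂ] H) : A.domain →ₗ[ℂ] H :=
  A.toFun + A.domain.subtype

@[simp]
theorem shift_apply (A : H →ₗ.[ℂ] H) (x : A.domain) : shift A x = A x + (x : H) := rfl

/-- The bounded everywhere defined operator `R` is a resolvent `(A + I)⁻¹` of `A`. -/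
def IsShiftInverse (A : H →ₗ.[ℂ] H) (R : H →L[ℂ] H) : Prop :=
  (∀ f : H, ∃ hf : R f ∈ A.domain, shift A ⟨R f, hf⟩ = f) ∧
    ∀ u : A.domain, R (shift A u) = u

open scoped Classical in
/-- The resolvent `(A + I)⁻¹` as a bounded operator on `H`; it exists for every nonnegative
self-adjoint operator, see `shiftInverse_spec`. -/
noncomputable def shiftInverse (A : H →ₗ.[ℂ] H) : H →L[ℂ] H :=
  if h : ∃ R : H →L[ℂ] H, IsShiftInverse A R then h.choose else 0

theorem norm_le_norm_shift {A : H →ₗ.[ℂ] H} (hA : IsNonneg A) (u : A.domain) :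
    ‖(u : H)‖ ≤ ‖shift A u‖ := by
  have h1 : ‖(u : H)‖ ^ 2 ≤ (inner ℂ (u : H) (shift A u)).re := by
    have h2 := hA u
    have h3 : (inner ℂ (u : H) (u : H)).re = ‖(u : H)‖ ^ 2 :=
      inner_self_eq_norm_sq (𝕜 := ℂ) (u : H)
    rw [shift_apply, inner_add_right, Complex.add_re, h3]
    linarith
  have h4 : (inner ℂ (u : H) (shift A u)).re ≤ ‖(u : H)‖ * ‖shift A u‖ :=
    re_inner_le_norm (𝕜 := ℂ) (u : H) (shift A u)
  by_contra! hlt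
  have h5 : 0 < ‖(u : H)‖ := (norm_nonneg _).trans_lt hlt
  nlinarith

theorem shift_surjective [CompleteSpace H] {A : H →ₗ.[ℂ] H} (hA : IsSelfAdjoint A)
    (hpos : IsNonneg A) : Function.Surjective (shift A) := by
  have hclosed : IsClosed ((LinearMap.range (shift A) : Submodule ℂ H) : Set H) := by
    refine IsSeqClosed.isClosed fun x f hx hxf => ?_
    choose v hv using hx
    have hcau : CauchySeq (fun k => (v k : H)) := by
      refine Metric.cauchySeq_iff'.2 fun ε hε => ?_
      obtain ⟨N, hN⟩ := Metric.cauchySeq_iff'.1 hxf.cauchySeq ε hε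
      refine ⟨N, fun k hk => lt_of_le_of_lt ?_ (hN k hk)⟩
      have := norm_le_norm_shift hpos (v k - v N)
      rwa [map_sub, hv, hv, Submodule.coe_sub, ← dist_eq_norm, ← dist_eq_norm] at this
    obtain ⟨w, hw⟩ := cauchySeq_tendsto_of_complete hcau
    have hAw : Tendsto (fun k => A (v k)) atTop (𝓝 (f - w)) := by
      refine (hxf.sub hw).congr fun k => ?_
      rw [← hv k, shift_apply, add_sub_cancel_right]
    have hmem : (w, f - w) ∈ A.graph :=
      hA.isClosed.isSeqClosed (x := fun k => ((v k : H), A (v k)))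
        (fun k => A.mem_graph (v k)) (hw.prodMk_nhds hAw)
    obtain ⟨y, hy1, hy2⟩ := (LinearPMap.mem_graph_iff A).1 hmem
    refine ⟨y, ?_⟩
    rw [shift_apply, hy2, hy1]
    simp
  have horth : (LinearMap.range (shift A))ᗮ = ⊥ := by
    refine (Submodule.eq_bot_iff _).2 fun v hv => ?_
    have hv' : ∀ x : A.domain, inner ℂ (-v) (x : H) = inner ℂ v (A x) := by
      intro x
      have h1 := (Submodule.mem_orthogonal' _ _).1 hv (shift A x) ⟨x, rfl⟩
      rw [shift_apply, inner_add_right] at h1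
      rw [inner_neg_left]
      linear_combination -h1
    have hd : v ∈ A.adjoint.domain := LinearPMap.mem_adjoint_domain_of_exists v ⟨-v, hv'⟩
    have hval : A.adjoint ⟨v, hd⟩ = -v := LinearPMap.adjoint_apply_eq hA.dense_domain ⟨v, hd⟩ hv'
    have hg : (v, -v) ∈ A.graph := by
      have := A.adjoint.mem_graph ⟨v, hd⟩
      rw [hval] at this
      exact (congrArg LinearPMap.graph (LinearPMap.isSelfAdjoint_def.1 hA)) ▸ this
    obtain ⟨y, hy1, hy2⟩ := (LinearPMap.mem_graph_iff A).1 hg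
    have h0 := norm_le_norm_shift hpos y
    rw [shift_apply, hy2, hy1] at h0
    simpa using h0
  have htop : LinearMap.range (shift A) = ⊤ := by
    have := hclosed.completeSpace_coe
    exact (Submodule.orthogonal_eq_bot_iff).1 horth
  exact LinearMap.range_eq_top.1 htop

/-- The resolvent of a nonnegative self-adjoint operator is what its name says. -/
theorem shiftInverse_spec [CompleteSpace H] {A : H →ₗ.[ℂ] H} (hA : IsSelfAdjoint A)
    (hpos : IsNonneg A) : IsShiftInverse A (shiftInverse A) := by
  have hex : ∃ R : H →L[ℂ] H, IsShiftInverse A R := by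
    have hinj : Function.Injective (shift A) := by
      refine (injective_iff_map_eq_zero _).2 fun x hx => ?_
      have := norm_le_norm_shift hpos x
      rw [hx, norm_zero] at this
      simpa using this
    let e := LinearEquiv.ofBijective (shift A) ⟨hinj, shift_surjective hA hpos⟩
    refine ⟨(A.domain.subtype ∘ₗ (e.symm : H →ₗ[ℂ] A.domain)).mkContinuous 1 fun f => ?_, ?_, ?_⟩
    · have := norm_le_norm_shift hpos (e.symm f)
      rw [one_mul]
      exact this.trans_eq (congrArg norm (e.apply_symm_apply f))
    · exact fun f => ⟨(e.symm f).2, e.apply_symm_apply f⟩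
    · exact fun x => congrArg Subtype.val (e.symm_apply_apply x)
  rw [shiftInverse, dif_pos hex]
  exact hex.choose_spec

/-- `(A + I)^{-1/2}`, the nonnegative square root of the resolvent. -/
noncomputable def sqrtShiftInverse [CompleteSpace H] (A : H →ₗ.[ℂ] H) : H →L[ℂ] H :=
  CFC.sqrt (shiftInverse A)

/-- `(A + I)^{1/2}`, as the inverse of the injective operator `(A + I)^{-1/2}`. -/
noncomputable def sqrtShift [CompleteSpace H] (A : H →ₗ.[ℂ] H) : H →ₗ.[ℂ] H :=
  (((sqrtShiftInverse A : H →L[ℂ] H) : H →ₗ[ℂ] H).toPMap ⊤).inverse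

/-- The space `𝓗₁(A) = D(A^{1/2}) = D((A + I)^{1/2})` of the scale of `A`. -/
noncomputable def spaceOne [CompleteSpace H] (A : H →ₗ.[ℂ] H) : Submodule ℂ H :=
  (sqrtShift A).domain

/-! ### The negative spaces of the scale -/

/-- The vector space `H` with the (semi)norm `u ↦ ‖T u‖`. -/
def Renormed (_T : H →L[ℂ] H) : Type u := H

instance (T : H →L[ℂ] H) : AddCommGroup (Renormed T) := inferInstanceAs (AddCommGroup H)

instance (T : H →L[ℂ] H) : Module ℂ (Renormed T) := inferInstanceAs (Module ℂ H)

/-- The identity `H → Renormed T`. -/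
def toRenormed (T : H →L[ℂ] H) : H ≃ₗ[ℂ] Renormed T := LinearEquiv.refl ℂ H

/-- The operator `T` itself, as a map on the renormed space. -/
def renormedMap (T : H →L[ℂ] H) : Renormed T →ₗ[ℂ] H :=
  (T : H →ₗ[ℂ] H) ∘ₗ ((toRenormed T).symm : Renormed T →ₗ[ℂ] H)

noncomputable instance (T : H →L[ℂ] H) : SeminormedAddCommGroup (Renormed T) :=
  SeminormedAddCommGroup.induced (Renormed T) H (renormedMap T)

noncomputable instance (T : H →L[ℂ] H) : NormedSpace ℂ (Renormed T) :=
  NormedSpace.induced ℂ (Renormed T) H (renormedMap T)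

theorem norm_toRenormed (T : H →L[ℂ] H) (u : H) : ‖toRenormed T u‖ = ‖T u‖ := rfl

/-- `T` is an isometry of the renormed space into `H`. -/
noncomputable def renormedMapL (T : H →L[ℂ] H) : Renormed T →L[ℂ] H :=
  (renormedMap T).mkContinuous 1 (fun x => by rw [one_mul]; exact le_refl _)

/-- `𝓗₋₂(A)`: the completion of `H` in the norm `‖(A + I)⁻¹ u‖`. -/
abbrev MinusTwo (A : H →ₗ.[ℂ] H) : Type u :=
  UniformSpace.Completion (Renormed (shiftInverse A))

/-- `𝓗₋₁(A)`: the completion of `H` in the norm `‖(A + I)^{-1/2} u‖`. -/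
abbrev MinusOne [CompleteSpace H] (A : H →ₗ.[ℂ] H) : Type u :=
  UniformSpace.Completion (Renormed (sqrtShiftInverse A))

/-- The dense inclusion of `H` into `𝓗₋₂(A)`. -/
noncomputable def incl (A : H →ₗ.[ℂ] H) : H →ₗ[ℂ] MinusTwo A :=
  (UniformSpace.Completion.toComplₗᵢ (𝕜 := ℂ) (E := Renormed (shiftInverse A))).toLinearMap ∘ₗ
    (toRenormed (shiftInverse A) : H →ₗ[ℂ] Renormed (shiftInverse A))

/-- The natural map `𝓗₋₁(A) → 𝓗₋₂(A)`, the continuous extension of the identity of `H`. -/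
noncomputable def inclMinusOne [CompleteSpace H] (A : H →ₗ.[ℂ] H) : MinusOne A → MinusTwo A :=
  UniformSpace.Completion.map
    (fun x => toRenormed (shiftInverse A) ((toRenormed (sqrtShiftInverse A)).symm x))

/-- The continuous extension of `(A + I)⁻¹` to an isometry of `𝓗₋₂(A)` onto `H`. -/
noncomputable def extResolvent [CompleteSpace H] (A : H →ₗ.[ℂ] H) : MinusTwo A →L[ℂ] H :=
  (renormedMapL (shiftInverse A)).extend UniformSpace.Completion.toComplL

/-- The pairing `⟨ψ, u⟩ = ((A + I) u, (A + I)⁻¹ ψ)`, linear in `u ∈ D(A)`. (Mathlib's inner product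
is linear in the second variable.) -/
noncomputable def pairing [CompleteSpace H] (A : H →ₗ.[ℂ] H) (ψ : MinusTwo A) :
    A.domain →ₗ[ℂ] ℂ :=
  (innerₛₗ ℂ (extResolvent A ψ)) ∘ₗ shift A

/-- The continuous extension to `𝓗₋₂(A)` of an operator `V` on `H`. -/
noncomputable def extOperator (A : H →ₗ.[ℂ] H) (V : H → H) : MinusTwo A → MinusTwo A :=
  UniformSpace.Completion.map
    (fun x => toRenormed (shiftInverse A) (V ((toRenormed (shiftInverse A)).symm x)))

/-! ### Symmetries -/

/-- `A` is a nonzero operator with `U_t A = p(t) A U_t` (an equality of operators, domains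
included) for all `t`. -/
structure IsHomogeneous {𝔗 : Set ℝ} (U : 𝔗 → (H ≃ₗᵢ[ℂ] H)) (p : 𝔗 → ℝ)
    (A : H →ₗ.[ℂ] H) : Prop where
  ne_zero : ∃ x : A.domain, A x ≠ 0
  mem_iff : ∀ (t : 𝔗) (f : H), f ∈ A.domain ↔ U t f ∈ A.domain
  map_eq : ∀ (t : 𝔗) (f : A.domain) (hf : U t f ∈ A.domain),
    U t (A f) = (p t : ℂ) • A ⟨U t f, hf⟩

/-- `𝕌_t ψ = ξ(t) ψ` for all `t`. -/
def IsInvariant {𝔗 : Set ℝ} (A : H →ₗ.[ℂ] H) (U : 𝔗 → (H ≃ₗᵢ[ℂ] H)) (ξ : 𝔗 → ℝ)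
    (ψ : MinusTwo A) : Prop :=
  ∀ t : 𝔗, extOperator A (U t) ψ = (ξ t : ℂ) • ψ

/-! ### Friedrichs and Krein-von Neumann extensions -/

/-- A sequence in the domain of `A` is Cauchy for the form `(A g, g)`:
`(A (h k - h l), h k - h l) → 0` as `k, l → ∞`. -/
def IsFormCauchy (A : H →ₗ.[ℂ] H) (h : ℕ → A.domain) : Prop :=
  Tendsto (fun m : ℕ × ℕ =>
    (inner ℂ ((h m.1 - h m.2 : A.domain) : H) (A (h m.1 - h m.2))).re) atTop (𝓝 0)

theorem IsFormCauchy.add {A : H →ₗ.[ℂ] H} (hA : IsNonneg A) {h k : ℕ → A.domain}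
    (hh : IsFormCauchy A h) (hk : IsFormCauchy A k) : IsFormCauchy A (fun n => h n + k n) := by
  have key : ∀ x y : A.domain, (inner ℂ ((x + y : A.domain) : H) (A (x + y))).re ≤
      2 * (inner ℂ (x : H) (A x)).re + 2 * (inner ℂ (y : H) (A y)).re := by
    intro x y
    have h1 := hA (x - y)
    simp only [LinearPMap.map_sub, LinearPMap.map_add, Submodule.coe_sub, Submodule.coe_add,
      inner_sub_left, inner_sub_right, inner_add_left, inner_add_right, Complex.sub_re,
      Complex.add_re] at h1 ⊢
    linarith
  have hlim := (hh.const_mul 2).add (hk.const_mul 2)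
  simp only [mul_zero, add_zero] at hlim
  refine squeeze_zero (fun m => hA _) (fun m => ?_) hlim
  have h2 := key (h m.1 - h m.2) (k m.1 - k m.2)
  rwa [sub_add_sub_comm] at h2

theorem IsFormCauchy.smul {A : H →ₗ.[ℂ] H} {h : ℕ → A.domain} (c : ℂ)
    (hh : IsFormCauchy A h) : IsFormCauchy A (fun n => c • h n) := by
  have hlim := hh.const_mul (‖c‖ ^ 2)
  rw [mul_zero] at hlim
  refine hlim.congr (fun m => ?_)
  rw [← smul_sub, LinearPMap.map_smul, Submodule.coe_smul, inner_smul_left, inner_smul_right,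
    ← mul_assoc, ← Complex.normSq_eq_conj_mul_self, Complex.re_ofReal_mul,
    Complex.normSq_eq_norm_sq]

theorem isFormCauchy_zero (A : H →ₗ.[ℂ] H) : IsFormCauchy A (fun _ => 0) := by
  simp [IsFormCauchy]

/-- For nonnegative `A`: the domain of the closure of the form `(A f, f)`, i.e. all `f` for which
there are `h k ∈ D(A)` with `h k → f` and `(A (h k - h l), h k - h l) → 0`. Only used for
nonnegative `A`. -/
def formDomain (A : H →ₗ.[ℂ] H) : Submodule ℂ H where
  carrier := {f | IsNonneg A → ∃ h : ℕ → A.domain,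
    Tendsto (fun k => (h k : H)) atTop (𝓝 f) ∧ IsFormCauchy A h}
  zero_mem' := fun _ => ⟨fun _ => 0, by simp, isFormCauchy_zero A⟩
  add_mem' := by
    intro f g hf hg hA
    obtain ⟨h, h1, h2⟩ := hf hA
    obtain ⟨k, k1, k2⟩ := hg hA
    exact ⟨fun n => h n + k n, by simpa using h1.add k1, h2.add hA k2⟩
  smul_mem' := by
    intro c f hf hA
    obtain ⟨h, h1, h2⟩ := hf hA
    exact ⟨fun n => c • h n, by simpa using h1.const_smul c, h2.smul c⟩

/-- For nonnegative `A`: all `g` for which there are `h k ∈ D(A)` with `A (h k) → g` and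
`(A (h k - h l), h k - h l) → 0`. Only used for nonnegative `A`. -/
def formRange (A : H →ₗ.[ℂ] H) : Submodule ℂ H where
  carrier := {g | IsNonneg A → ∃ h : ℕ → A.domain,
    Tendsto (fun k => A (h k)) atTop (𝓝 g) ∧ IsFormCauchy A h}
  zero_mem' := fun _ => ⟨fun _ => 0, by simp, isFormCauchy_zero A⟩
  add_mem' := by
    intro f g hf hg hA
    obtain ⟨h, h1, h2⟩ := hf hA
    obtain ⟨k, k1, k2⟩ := hg hA
    exact ⟨fun n => h n + k n, by simpa [LinearPMap.map_add] using h1.add k1, h2.add hA k2⟩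
  smul_mem' := by
    intro c f hf hA
    obtain ⟨h, h1, h2⟩ := hf hA
    exact ⟨fun n => c • h n, by simpa [LinearPMap.map_smul] using h1.const_smul c, h2.smul c⟩

/-- The Friedrichs extension of a densely defined nonnegative operator `A`: the restriction of
`A*` to the vectors of `D(A*)` in the domain of the closed form of `A`. -/
noncomputable def friedrichs [CompleteSpace H] (A : H →ₗ.[ℂ] H) : H →ₗ.[ℂ] H :=
  A.adjoint.domRestrict (formDomain A)

/-- The Krein-von Neumann extension of a densely defined nonnegative operator `A`: the restriction
of `A*` to those `f ∈ D(A*)` for which there are `h k ∈ D(A)` with `A (h k) → A* f` and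
`(A (h k - h l), h k - h l) → 0`. -/
noncomputable def kreinVonNeumann [CompleteSpace H] (A : H →ₗ.[ℂ] H) : H →ₗ.[ℂ] H :=
  A.adjoint.domRestrict (((formRange A).comap A.adjoint.toFun).map A.adjoint.domain.subtype)

/-- Two extensions `B₁`, `B₂` (restrictions of `A*`) of the symmetric operator `A` are transversal:
`D(B₁) + D(B₂) = D(A*)`. -/
def Transversal [CompleteSpace H] (A B₁ B₂ : H →ₗ.[ℂ] H) : Prop :=
  B₁.domain ⊔ B₂.domain = A.adjoint.domain

/-! ### The symmetric operator of a singular perturbation and its defect subspaces -/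

section Perturbation

variable [CompleteSpace H] (A₀ : H →ₗ.[ℂ] H) {n : ℕ} (ψ : Fin n → MinusTwo A₀)

/-- `A_sym`: the restriction of `A₀` to all `u ∈ D(A₀)` with `⟨ψ_j, u⟩ = 0` for every `j`. -/
noncomputable def symOp : H →ₗ.[ℂ] H :=
  A₀.domRestrict ((⨅ j, LinearMap.ker (pairing A₀ (ψ j))).map A₀.domain.subtype)

/-- The defect subspace `𝓗 = ker (A_sym* + I)`. -/
noncomputable def defect : Submodule ℂ H :=
  (LinearMap.ker (shift (symOp A₀ ψ).adjoint)).map (symOp A₀ ψ).adjoint.domain.subtype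

/-- `𝓗' = 𝓗 ∩ 𝓗₁(A₀)`. -/
noncomputable def defect' : Submodule ℂ H :=
  defect A₀ ψ ⊓ spaceOne A₀

/-- `𝓗'' = 𝓗 ⊖ 𝓗'`. -/
noncomputable def defect'' : Submodule ℂ H :=
  defect A₀ ψ ⊓ (defect' A₀ ψ)ᗮ

/-- The restriction `S` of the Friedrichs extension `A_F` of `A_sym` to
`(A_F + I)⁻¹ [R(A_sym + I) ⊕ K]`. -/
noncomputable def intermediateOp (K : Submodule ℂ H) : H →ₗ.[ℂ] H :=
  (friedrichs (symOp A₀ ψ)).domRestrict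
    (((LinearMap.range (shift (symOp A₀ ψ)) ⊔ K).comap
      (shift (friedrichs (symOp A₀ ψ)))).map (friedrichs (symOp A₀ ψ)).domain.subtype)

/-! ### Admissible matrices and admissible operators -/

/-- The vectors `h_j = (A₀ + I)⁻¹ ψ_j`; they form a basis of `𝓗`. -/
noncomputable def defectVec (j : Fin n) : H := extResolvent A₀ (ψ j)

/-- The parametrization `(u, α) ↦ u + ∑ α_p h_p` of `D(A_sym*) = D(A₀) ∔ 𝓗`. -/
noncomputable def assemble : (A₀.domain × (Fin n → ℂ)) →ₗ[ℂ] H :=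
  LinearMap.coprod A₀.domain.subtype (Fintype.linearCombination ℂ (defectVec A₀ ψ))

/-- The extended functional `⟨ψ_j^ex, f⟩ = ⟨ψ_j, u⟩ + ∑_p α_p r_{jp}` of `f = u + ∑ α_p h_p`,
in terms of the (unique) coordinates `(u, α)` of `f`. -/
noncomputable def extFunctional (R : Matrix (Fin n) (Fin n) ℂ) (j : Fin n) :
    (A₀.domain × (Fin n → ℂ)) →ₗ[ℂ] ℂ :=
  LinearMap.coprod (pairing A₀ (ψ j)) (Fintype.linearCombination ℂ (R j))

/-- `R` is an admissible matrix: it is Hermitian, and if `χ = ∑ c_j ψ_j` lies in `𝓗₋₁(A₀)`, then for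
`h = (A₀ + I)⁻¹ χ ∈ 𝓗₁(A₀)` and all `f ∈ D(A_sym*) ∩ 𝓗₁(A₀)` the extended functional of `χ` at `f`
equals `((A₀ + I)^{1/2} f, (A₀ + I)^{1/2} h)`. The pairing `⟨ψ, f⟩` is conjugate linear in `ψ`, hence
the conjugated coefficients. -/
def IsAdmissibleMatrix (R : Matrix (Fin n) (Fin n) ℂ) : Prop :=
  R.IsHermitian ∧
    ∀ c : Fin n → ℂ, (∑ j, c j • ψ j) ∈ Set.range (inclMinusOne A₀) →
      ∃ hh : extResolvent A₀ (∑ j, c j • ψ j) ∈ spaceOne A₀,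
        ∀ (w : A₀.domain × (Fin n → ℂ)) (hf : assemble A₀ ψ w ∈ spaceOne A₀),
          inner ℂ (sqrtShift A₀ ⟨extResolvent A₀ (∑ j, c j • ψ j), hh⟩)
              (sqrtShift A₀ ⟨assemble A₀ ψ w, hf⟩) =
            ∑ j, (starRingEnd ℂ) (c j) * extFunctional A₀ ψ R j w

/-- The restriction of `A_sym*` to all `f ∈ D(A_sym*)` with `⟨ψ_j^ex, f⟩ = 0` for every `j`. -/
noncomputable def matrixOp (R : Matrix (Fin n) (Fin n) ℂ) : H →ₗ.[ℂ] H :=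
  (symOp A₀ ψ).adjoint.domRestrict
    ((⨅ j, LinearMap.ker (extFunctional A₀ ψ R j)).map (assemble A₀ ψ))

/-- An admissible operator for the regularization of `A₀ + ∑ b_ij ⟨ψ_j, ·⟩ ψ_i`. -/
def IsAdmissible (B : H →ₗ.[ℂ] H) : Prop :=
  ∃ R : Matrix (Fin n) (Fin n) ℂ, IsAdmissibleMatrix A₀ ψ R ∧ B = matrixOp A₀ ψ R

end Perturbation

end SingPert

namespace SingPert

universe u

variable {H : Type u} [NormedAddCommGroup H] [InnerProductSpace ℂ H]

/-! ### Graphs of restrictions, adjoints and extremal extensions -/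

/-! Write G = (A₀ + I)⁻¹. Since ⟨ψ_j, u⟩ is the inner product of h_j with (A₀ + I)u, the domain of
A_sym is G(𝓗ᗮ), and every operator involved can be described by bounded operators and subspaces. Let
L be the preimage of 𝓗 under G^{1/2} and P the projection onto Lᗮ. Then A_F has resolvent G_F =
G^{1/2} P G^{1/2}, S is its restriction with x = f + g in 𝓗ᗮ + K, where K is the chosen subspace,
and (f, g) belongs to the graph of S* exactly when f - G_F(f + g) lies in 𝓗 ∩ Kᗮ.

Let S_N be the Krein–von Neumann extension of S. It is homogeneous because its graph is cut out of
S* by a limit condition, and both are preserved by (f, g) ↦ (U f, p⁻¹ U g)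
(`Intertwines.kreinVonNeumann`). For admissibility, the dimension condition on K gives 𝓗' ∩ Kᗮ = 0
and 𝓗 = 𝓗' + (𝓗 ∩ Kᗮ). The part 𝓗' is reached by G - G_F on K, and 𝓗 ∩ Kᗮ is reached by
transversality of A_F and A_N. So D(S_N) + D(A₀) = D(A_sym*), and the symmetric operator S_N is
given by a Hermitian matrix (`exists_eq_matrixOp`). Because 𝓗' ∩ Kᗮ = 0, the vectors of D(S_N) in 𝓗₁
lie in the form domain of A_sym, that is, their images under (A₀ + I)^{1/2} are orthogonal to L;
this is what makes the matrix admissible (`isAdmissible`).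

Uniqueness: evaluating the boundary condition of a homogeneous operator on U_t f gives r_ij (ξ_i ξ_j
- p) = ξ_i (1 - p) ⟨h_i, U_t h_j⟩ (`coeff_eq`). At a point where β_ij ≠ 0 the factor on the left is
nonzero, so r_ij is determined. -/

theorem mem_graph_domRestrict {A : H →ₗ.[ℂ] H} {D : Submodule ℂ H} {f g : H} :
    (f, g) ∈ (A.domRestrict D).graph ↔ f ∈ D ∧ (f, g) ∈ A.graph := by
  simp only [LinearPMap.mem_graph_iff]
  constructor
  · rintro ⟨x, hx, hg⟩
    have h2 := (Submodule.mem_inf.1 x.2)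
    refine ⟨hx ▸ h2.1, ⟨x, h2.2⟩, hx, ?_⟩
    rw [← LinearPMap.domRestrict_apply (x := x) rfl]
    exact hg
  · rintro ⟨hf, x, hx, hg⟩
    refine ⟨⟨x, ⟨by rw [hx]; exact hf, x.2⟩⟩, hx, ?_⟩
    rw [← hg]
    exact LinearPMap.domRestrict_apply rfl

theorem mem_graph_adjoint [CompleteSpace H] {B : H →ₗ.[ℂ] H} (hB : Dense (B.domain : Set H))
    {f g : H} :
    (f, g) ∈ B.adjoint.graph ↔ ∀ u v, (u, v) ∈ B.graph → inner ℂ g u = inner ℂ f v := by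
  constructor
  · intro h u v huv
    obtain ⟨y, rfl, rfl⟩ := (LinearPMap.mem_graph_iff _).1 h
    obtain ⟨x, rfl, rfl⟩ := (LinearPMap.mem_graph_iff _).1 huv
    exact LinearPMap.adjoint_isFormalAdjoint hB y x
  · intro h
    have h' : ∀ x : B.domain, inner ℂ g (x : H) = inner ℂ f (B x) :=
      fun x => h _ _ (B.mem_graph x)
    have hd := LinearPMap.mem_adjoint_domain_of_exists f ⟨g, h'⟩
    exact (LinearPMap.mem_graph_iff _).2
      ⟨⟨f, hd⟩, rfl, LinearPMap.adjoint_apply_eq hB ⟨f, hd⟩ h'⟩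

theorem mem_graph_kreinVonNeumann [CompleteSpace H] {A : H →ₗ.[ℂ] H} {f g : H} :
    (f, g) ∈ (kreinVonNeumann A).graph ↔ (f, g) ∈ A.adjoint.graph ∧ g ∈ formRange A := by
  rw [kreinVonNeumann, mem_graph_domRestrict, and_comm]
  refine and_congr_right fun h => ?_
  obtain ⟨y, rfl, rfl⟩ := (LinearPMap.mem_graph_iff _).1 h
  simp

theorem mem_graph_friedrichs [CompleteSpace H] {A : H →ₗ.[ℂ] H} {f g : H} :
    (f, g) ∈ (friedrichs A).graph ↔ (f, g) ∈ A.adjoint.graph ∧ f ∈ formDomain A := by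
  rw [friedrichs, mem_graph_domRestrict, and_comm]

theorem mem_formDomain {A : H →ₗ.[ℂ] H} (hA : IsNonneg A) {f : H} :
    f ∈ formDomain A ↔ ∃ h : ℕ → A.domain,
      Tendsto (fun k => (h k : H)) atTop (𝓝 f) ∧ IsFormCauchy A h :=
  ⟨fun h => h hA, fun h _ => h⟩

theorem formRange_mono {A B : H →ₗ.[ℂ] H} (hA : IsNonneg A) (hAB : A ≤ B) :
    formRange A ≤ formRange B := by
  intro g hg _
  obtain ⟨h, h1, h2⟩ := hg hA
  have hval : ∀ x : A.domain, B ⟨x, hAB.1 x.2⟩ = A x := fun x => (hAB.2 rfl).symm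
  refine ⟨fun k => ⟨h k, hAB.1 (h k).2⟩, h1.congr fun k => (hval _).symm, ?_⟩
  refine Tendsto.congr (fun m => ?_) h2
  rw [← hval]
  rfl

theorem mem_formRange_of_mem_graph {A : H →ₗ.[ℂ] H} {u v : H} (h : (u, v) ∈ A.graph) :
    v ∈ formRange A := by
  obtain ⟨x, rfl, rfl⟩ := (LinearPMap.mem_graph_iff _).1 h
  exact fun _ => ⟨fun _ => x, tendsto_const_nhds, by simp [IsFormCauchy]⟩

/-- `A` is symmetric. -/
def IsSymm (A : H →ₗ.[ℂ] H) : Prop :=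
  ∀ x y : A.domain, inner ℂ (A x) (y : H) = inner ℂ (x : H) (A y)

theorem le_kreinVonNeumann [CompleteSpace H] {A : H →ₗ.[ℂ] H} (hd : Dense (A.domain : Set H))
    (hs : IsSymm A) : A ≤ kreinVonNeumann A := by
  refine LinearPMap.le_of_le_graph ?_
  rintro ⟨f, g⟩ h
  refine mem_graph_kreinVonNeumann.2 ⟨(mem_graph_adjoint hd).2 fun u v huv => ?_,
    mem_formRange_of_mem_graph h⟩
  obtain ⟨x, rfl, rfl⟩ := (LinearPMap.mem_graph_iff _).1 h
  obtain ⟨y, rfl, rfl⟩ := (LinearPMap.mem_graph_iff _).1 huv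
  exact hs x y

/-! ### Symmetry of the Krein–von Neumann extension. -/

/-- The Cauchy-Schwarz inequality for the form of a nonnegative symmetric operator. -/
theorem norm_inner_apply_sq_le {A : H →ₗ.[ℂ] H} (hA : IsNonneg A) (hs : IsSymm A)
    (x y : A.domain) : ‖inner ℂ (A x) (y : H)‖ ^ 2 ≤
      (inner ℂ (x : H) (A x)).re * (inner ℂ (y : H) (A y)).re := by
  let c : PreInnerProductSpace.Core ℂ A.domain :=
    { inner := fun x y => inner ℂ (x : H) (A y)
      conj_inner_symm := fun x y => by rw [inner_conj_symm, hs]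
      re_inner_nonneg := hA
      add_left := fun x y z => inner_add_left _ _ _
      smul_left := fun x y r => inner_smul_left _ _ _ }
  have h := @InnerProductSpace.Core.inner_mul_inner_self_le ℂ A.domain _ _ _ c x y
  change ‖inner ℂ (x : H) (A y)‖ * ‖inner ℂ (y : H) (A x)‖ ≤
    (inner ℂ (x : H) (A x)).re * (inner ℂ (y : H) (A y)).re at h
  rw [norm_inner_symm (y : H), ← hs] at h
  rwa [sq]

theorem IsFormCauchy.bounded {A : H →ₗ.[ℂ] H} (hA : IsNonneg A) {h : ℕ → A.domain}
    (hh : IsFormCauchy A h) :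
    ∃ C : ℝ, 0 ≤ C ∧ ∀ᶠ k in atTop, (inner ℂ (h k : H) (A (h k))).re ≤ C := by
  have h1 : ∀ᶠ m : ℕ × ℕ in atTop,
      (inner ℂ ((h m.1 - h m.2 : A.domain) : H) (A (h m.1 - h m.2))).re ≤ 1 :=
    hh.eventually (eventually_le_nhds zero_lt_one)
  rw [← prod_atTop_atTop_eq, eventually_prod_iff] at h1
  obtain ⟨P, hP, Q, hQ, hPQ⟩ := h1
  obtain ⟨l, hl⟩ := hQ.exists
  refine ⟨2 * 1 + 2 * (inner ℂ (h l : H) (A (h l))).re, by linarith [hA (h l)], ?_⟩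
  filter_upwards [hP] with k hk
  have h2 := hPQ hk hl
  -- Parallelogram law for the form at h k - h l and h l: nonnegativity at their difference bounds
  -- the form at their sum h k.
  have h3 := hA (h k - h l - h l)
  simp only [LinearPMap.map_sub, Submodule.coe_sub, inner_sub_left, inner_sub_right,
    Complex.sub_re] at h2 h3
  linarith

/-- The Krein-von Neumann extension of a nonnegative symmetric operator is symmetric. -/
theorem kreinVonNeumann_symm [CompleteSpace H] {A : H →ₗ.[ℂ] H} (hd : Dense (A.domain : Set H))
    (hA : IsNonneg A) (hs : IsSymm A) {f g f' g' : H} (h : (f, g) ∈ (kreinVonNeumann A).graph)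
    (h' : (f', g') ∈ (kreinVonNeumann A).graph) : inner ℂ g f' = inner ℂ f g' := by
  rw [mem_graph_kreinVonNeumann] at h h'
  obtain ⟨u, hu, hu'⟩ := h.2 hA
  obtain ⟨v, hv, hv'⟩ := h'.2 hA
  have hf := fun x : A.domain => (mem_graph_adjoint hd).1 h.1 x (A x) (A.mem_graph x)
  have hf' : ∀ x : A.domain, inner ℂ (A x) f' = inner ℂ (x : H) g' := by
    intro x
    have := (mem_graph_adjoint hd).1 h'.1 x (A x) (A.mem_graph x)
    rw [← inner_conj_symm, ← this, inner_conj_symm]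
  -- The two sides of the claim are the two iterated limits of the double sequence ⟨A u_k, v_l⟩ =
  -- ⟨u_k, A v_l⟩. Form Cauchy–Schwarz makes it Cauchy in k uniformly in l, so the limits can be
  -- interchanged.
  have ha : Tendsto (fun k => inner ℂ (u k : H) g') atTop (𝓝 (inner ℂ g f')) := by
    exact (hu.inner tendsto_const_nhds).congr fun k => hf' _
  have hb : Tendsto (fun l => inner ℂ g (v l : H)) atTop (𝓝 (inner ℂ f g')) := by
    exact (tendsto_const_nhds.inner hv).congr fun l => (hf _).symm
  have hx : ∀ k, Tendsto (fun l => inner ℂ (A (u k)) (v l : H)) atTop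
      (𝓝 (inner ℂ (u k : H) g')) := by
    intro k
    exact (tendsto_const_nhds.inner hv).congr fun l => (hs _ _).symm
  have hy : ∀ l, Tendsto (fun k => inner ℂ (A (u k)) (v l : H)) atTop
      (𝓝 (inner ℂ g (v l : H))) := fun l => hu.inner tendsto_const_nhds
  obtain ⟨C, hC, hvC⟩ := hv'.bounded hA
  refine eq_of_forall_dist_le fun ε hε => ?_
  -- The form of v_l is eventually at most C, so this bound times C is at most ε²; C + 1 avoids
  -- dividing by zero.
  have h1 : ∀ᶠ m : ℕ × ℕ in atTop,
      (inner ℂ ((u m.1 - u m.2 : A.domain) : H) (A (u m.1 - u m.2))).re ≤ ε ^ 2 / (C + 1) :=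
    hu'.eventually (eventually_le_nhds (by positivity))
  rw [← prod_atTop_atTop_eq, eventually_prod_iff] at h1
  obtain ⟨P, hP, Q, hQ, hPQ⟩ := h1
  have hkey : ∀ᶠ l in atTop, ∀ k, P k → ∀ k', Q k' →
      dist (inner ℂ (A (u k)) (v l : H)) (inner ℂ (A (u k')) (v l : H)) ≤ ε := by
    filter_upwards [hvC] with l hl k hk k' hk'
    have h2 := norm_inner_apply_sq_le hA hs (u k - u k') (v l)
    rw [LinearPMap.map_sub, inner_sub_left, ← dist_eq_norm] at h2
    refine abs_le_of_sq_le_sq' (h2.trans ?_) hε.le |>.2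
    rw [← LinearPMap.map_sub]
    calc _ ≤ ε ^ 2 / (C + 1) * C :=
          mul_le_mul (hPQ hk hk') hl (hA _) (by positivity)
      _ ≤ ε ^ 2 := by
          rw [div_mul_eq_mul_div, div_le_iff₀ (by positivity)]
          nlinarith [sq_nonneg ε]
  have hkey2 : ∀ᶠ l in atTop, ∀ k, P k →
      dist (inner ℂ (A (u k)) (v l : H)) (inner ℂ g (v l : H)) ≤ ε := by
    filter_upwards [hkey] with l hl k hk
    exact le_of_tendsto (tendsto_const_nhds.dist (hy l)) (hQ.mono fun k' hk' => hl k hk k' hk')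
  have hkey3 : ∀ k, P k → dist (inner ℂ (u k : H) g') (inner ℂ f g') ≤ ε := fun k hk =>
    le_of_tendsto ((hx k).dist hb) (hkey2.mono fun l hl => hl k hk)
  exact le_of_tendsto (ha.dist tendsto_const_nhds) (hP.mono hkey3)

/-! ### Intertwining with a unitary operator -/

/-- `V B V⁻¹ = q B`, in terms of the graph of `B` (for `q ≠ 0`). -/
def Intertwines (V : H ≃ₗᵢ[ℂ] H) (q : ℝ) (B : H →ₗ.[ℂ] H) : Prop :=
  ∀ f g, (f, g) ∈ B.graph ↔ (V f, ((q⁻¹ : ℝ) : ℂ) • V g) ∈ B.graph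

theorem smul_map_smul_symm (V : H ≃ₗᵢ[ℂ] H) {q : ℝ} (hq : q ≠ 0) (g : H) :
    ((q⁻¹ : ℝ) : ℂ) • V (((q⁻¹⁻¹ : ℝ) : ℂ) • V.symm g) = g := by
  rw [map_smul, smul_smul, V.apply_symm_apply, ← Complex.ofReal_mul, mul_inv_cancel₀
    (inv_ne_zero hq), Complex.ofReal_one, one_smul]

theorem Intertwines.symm {V : H ≃ₗᵢ[ℂ] H} {q : ℝ} (hq : q ≠ 0) {B : H →ₗ.[ℂ] H}
    (h : Intertwines V q B) : Intertwines V.symm q⁻¹ B := by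
  intro f g
  rw [h (V.symm f), smul_map_smul_symm V hq, V.apply_symm_apply]

theorem Intertwines.of_forall {V : H ≃ₗᵢ[ℂ] H} {q : ℝ} (hq : q ≠ 0) {B : H →ₗ.[ℂ] H}
    (h : ∀ f g, (f, g) ∈ B.graph → (V f, ((q⁻¹ : ℝ) : ℂ) • V g) ∈ B.graph)
    (h' : ∀ f g, (f, g) ∈ B.graph → (V.symm f, ((q⁻¹⁻¹ : ℝ) : ℂ) • V.symm g) ∈ B.graph) :
    Intertwines V q B := by
  intro f g
  refine ⟨h f g, fun h1 => ?_⟩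
  have h2 := h' _ _ h1
  have h3 := smul_map_smul_symm V.symm (inv_ne_zero hq) g
  rw [inv_inv, V.symm_symm, V.symm_apply_apply] at *
  rwa [h3] at h2

theorem Intertwines.adjoint_mem [CompleteSpace H] {V : H ≃ₗᵢ[ℂ] H} {q : ℝ}
    {B : H →ₗ.[ℂ] H} (hd : Dense (B.domain : Set H)) (h : Intertwines V.symm q⁻¹ B) {f g : H}
    (hfg : (f, g) ∈ B.adjoint.graph) (hq : q ≠ 0) :
    (V f, ((q⁻¹ : ℝ) : ℂ) • V g) ∈ B.adjoint.graph := by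
  rw [mem_graph_adjoint hd] at hfg ⊢
  intro u v huv
  have h1 := hfg _ _ ((h u v).1 huv)
  have hq' : (q : ℂ) ≠ 0 := by exact_mod_cast hq
  have h2 : ∀ x y : H, inner ℂ x (V.symm y) = inner ℂ (V x) y := fun x y => by
    rw [← V.inner_map_map, V.apply_symm_apply]
  rw [inner_smul_right, h2, h2] at h1
  rw [inner_smul_left, h1]
  simp [hq']

theorem Intertwines.formRange_mem {V : H ≃ₗᵢ[ℂ] H} {q : ℝ} {B : H →ₗ.[ℂ] H}
    (h : Intertwines V q B) {g : H} (hg : g ∈ formRange B) :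
    ((q⁻¹ : ℝ) : ℂ) • V g ∈ formRange B := by
  intro hB
  obtain ⟨u, h1, h2⟩ := hg hB
  have hm : ∀ x : B.domain, ∃ y : B.domain, (y : H) = V x ∧ B y = ((q⁻¹ : ℝ) : ℂ) • V (B x) :=
    fun x => (LinearPMap.mem_graph_iff _).1 ((h _ _).1 (B.mem_graph x))
  choose w hw hBw using hm
  refine ⟨fun k => w (u k), ?_, ?_⟩
  · simp_rw [hBw]
    exact (((V.continuous.tendsto g).comp h1).const_smul _)
  -- V is unitary, so the form along the transformed sequence is the old form times q⁻¹.
  · have h3 := h2.const_mul q⁻¹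
    rw [mul_zero] at h3
    refine h3.congr fun m => ?_
    rw [LinearPMap.map_sub, LinearPMap.map_sub, Submodule.coe_sub, Submodule.coe_sub, hw, hw, hBw,
      hBw, ← smul_sub, ← map_sub, ← map_sub, inner_smul_right, V.inner_map_map,
      Complex.re_ofReal_mul]

theorem Intertwines.kreinVonNeumann [CompleteSpace H] {V : H ≃ₗᵢ[ℂ] H} {q : ℝ} (hq : q ≠ 0)
    {B : H →ₗ.[ℂ] H} (hd : Dense (B.domain : Set H)) (h : Intertwines V q B) :
    Intertwines V q (kreinVonNeumann B) := by
  refine .of_forall hq ?_ ?_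
  · intro f g hfg
    rw [mem_graph_kreinVonNeumann] at hfg ⊢
    exact ⟨(h.symm hq).adjoint_mem hd hfg.1 hq, h.formRange_mem hfg.2⟩
  · intro f g hfg
    rw [mem_graph_kreinVonNeumann] at hfg ⊢
    refine ⟨Intertwines.adjoint_mem hd ?_ hfg.1 (inv_ne_zero hq),
      (h.symm hq).formRange_mem hfg.2⟩
    rwa [inv_inv, V.symm_symm]

theorem IsHomogeneous.intertwines {𝔗 : Set ℝ} {U : 𝔗 → (H ≃ₗᵢ[ℂ] H)} {p : 𝔗 → ℝ}
    {B : H →ₗ.[ℂ] H} (h : IsHomogeneous U p B) (t : 𝔗) : p t ≠ 0 ∧ Intertwines (U t) (p t) B := by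
  -- If p(t) were 0, U_t A would vanish although U_t is injective and A is nonzero.
  have hp : p t ≠ 0 := by
    obtain ⟨x, hx⟩ := h.ne_zero
    intro h0
    have := h.map_eq t x ((h.mem_iff t x).1 x.2)
    rw [h0, Complex.ofReal_zero, zero_smul] at this
    exact hx (by simpa using this)
  have hp' : (p t : ℂ) ≠ 0 := by exact_mod_cast hp
  refine ⟨hp, fun f g => ⟨fun hfg => ?_, fun hfg => ?_⟩⟩
  · obtain ⟨x, rfl, rfl⟩ := (LinearPMap.mem_graph_iff _).1 hfg
    have hx := (h.mem_iff t x).1 x.2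
    refine (LinearPMap.mem_graph_iff _).2 ⟨⟨_, hx⟩, rfl, ?_⟩
    rw [h.map_eq t x hx, smul_smul]
    simp [hp']
  · obtain ⟨x, hx, hg⟩ := (LinearPMap.mem_graph_iff _).1 hfg
    have hx' : U t f ∈ B.domain := by
      have := x.2
      rwa [hx] at this
    have hf := (h.mem_iff t f).2 hx'
    refine (LinearPMap.mem_graph_iff _).2 ⟨⟨f, hf⟩, rfl, (U t).injective ?_⟩
    have h1 : B ⟨U t f, hx'⟩ = B x := by congr 1; exact Subtype.ext hx.symm
    rw [h.map_eq t ⟨f, hf⟩ hx', h1, hg, smul_smul]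
    simp [hp']

theorem isHomogeneous_of_intertwines {𝔗 : Set ℝ} {U : 𝔗 → (H ≃ₗᵢ[ℂ] H)} {p : 𝔗 → ℝ}
    {B : H →ₗ.[ℂ] H} (hne : ∃ x : B.domain, B x ≠ 0) (hp : ∀ t, p t ≠ 0)
    (h : ∀ t, Intertwines (U t) (p t) B) : IsHomogeneous U p B := by
  have hmem : ∀ (t : 𝔗) (f : B.domain), (U t f, (((p t)⁻¹ : ℝ) : ℂ) • U t (B f)) ∈ B.graph :=
    fun t f => (h t f _).1 (B.mem_graph f)
  refine ⟨hne, fun t f => ⟨fun hf => ?_, fun hf => ?_⟩, fun t f hf => ?_⟩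
  · exact LinearPMap.mem_domain_of_mem_graph (hmem t ⟨f, hf⟩)
  · have h1 := ((h t).symm (hp t) _ _).1 (B.mem_graph ⟨_, hf⟩)
    have := LinearPMap.mem_domain_of_mem_graph h1
    rwa [LinearIsometryEquiv.symm_apply_apply] at this
  · have h1 := B.mem_graph_snd_inj (hmem t f) (B.mem_graph ⟨_, hf⟩) rfl
    have hp' : (p t : ℂ) ≠ 0 := by exact_mod_cast hp t
    rw [← h1, smul_smul]
    simp [hp']

/-! ### Restrictions of operators with a bounded symmetric resolvent at `-1` -/

/-- `B` is the restriction of the inverse of `G`, shifted by `-1`, to `G M`. -/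
def IsResolventRestriction (B : H →ₗ.[ℂ] H) (G : H →L[ℂ] H) (M : Submodule ℂ H) : Prop :=
  ∀ f g, (f, g) ∈ B.graph ↔ f + g ∈ M ∧ G (f + g) = f

theorem IsResolventRestriction.mem_graph {B : H →ₗ.[ℂ] H} {G : H →L[ℂ] H} {M : Submodule ℂ H}
    (h : IsResolventRestriction B G M) {x : H} (hx : x ∈ M) : (G x, x - G x) ∈ B.graph := by
  rw [h]
  simpa using hx

theorem IsResolventRestriction.exists_eq {B : H →ₗ.[ℂ] H} {G : H →L[ℂ] H} {M : Submodule ℂ H}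
    (h : IsResolventRestriction B G M) (u : B.domain) :
    ∃ x ∈ M, (u : H) = G x ∧ B u = x - G x := by
  obtain ⟨h1, h2⟩ := (h _ _).1 (B.mem_graph u)
  exact ⟨_, h1, h2.symm, by rw [h2]; abel⟩

theorem IsResolventRestriction.isSymm {B : H →ₗ.[ℂ] H} {G : H →L[ℂ] H} {M : Submodule ℂ H}
    (h : IsResolventRestriction B G M) (hG : ∀ x y, inner ℂ (G x) y = inner ℂ x (G y)) :
    IsSymm B := by
  intro u v
  obtain ⟨x, -, hx, hx'⟩ := h.exists_eq u
  obtain ⟨y, -, hy, hy'⟩ := h.exists_eq v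
  rw [hx, hx', hy, hy', inner_sub_left, inner_sub_right, hG, hG]

/-- Graph elements have the form (G x, x - G x) with x ∈ M. By symmetry of G, the adjoint relation
tested on such a pair says that f - G(f + g) is orthogonal to x. -/
theorem IsResolventRestriction.mem_graph_adjoint [CompleteSpace H] {B : H →ₗ.[ℂ] H}
    {G : H →L[ℂ] H} {M : Submodule ℂ H} (h : IsResolventRestriction B G M)
    (hG : ∀ x y, inner ℂ (G x) y = inner ℂ x (G y)) (hd : Dense (B.domain : Set H)) {f g : H} :
    (f, g) ∈ B.adjoint.graph ↔ f - G (f + g) ∈ Mᗮ := by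
  rw [SingPert.mem_graph_adjoint hd, Submodule.mem_orthogonal']
  have key : ∀ x, inner ℂ (f - G (f + g)) x = inner ℂ f (x - G x) - inner ℂ g (G x) := by
    intro x
    rw [inner_sub_left, hG, inner_add_left, inner_sub_right]
    ring
  constructor
  · intro h1 x hx
    rw [key, h1 _ _ (h.mem_graph hx), sub_self]
  · intro h1 u v huv
    obtain ⟨h2, h3⟩ := (h u v).1 huv
    have h4 := h1 _ h2
    rw [key, h3, add_sub_cancel_left] at h4
    exact (sub_eq_zero.1 h4).symm

/-! ### The resolvent, its square root and the negative spaces -/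

/-- `UniformSpace.Completion.map` really extends a map only if that map is uniformly continuous.
This bound is the criterion used for `inclMinusOne` and for `extOperator`. -/
theorem uniformContinuous_renormed {S T : H →L[ℂ] H} (V : H →ₗ[ℂ] H) (C : ℝ)
    (h : ∀ x, ‖T (V x)‖ ≤ C * ‖S x‖) : UniformContinuous
      (fun x : Renormed S => toRenormed T (V ((toRenormed S).symm x))) :=
  AddMonoidHomClass.uniformContinuous_of_bound
    ((toRenormed T : H →ₗ[ℂ] Renormed T) ∘ₗ V ∘ₗ ((toRenormed S).symm : Renormed S →ₗ[ℂ] H)) C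
    fun x => h ((toRenormed S).symm x)

section Resolvent

variable [CompleteSpace H] {A : H →ₗ.[ℂ] H}

theorem mem_graph_iff_shiftInverse (hA : IsSelfAdjoint A) (hpos : IsNonneg A) {f g : H} :
    (f, g) ∈ A.graph ↔ shiftInverse A (f + g) = f := by
  obtain ⟨h1, h2⟩ := shiftInverse_spec hA hpos
  constructor
  · intro h
    obtain ⟨x, rfl, rfl⟩ := (LinearPMap.mem_graph_iff _).1 h
    rw [add_comm]
    exact h2 x
  · intro h
    obtain ⟨hf, h3⟩ := h1 (f + g)
    refine (LinearPMap.mem_graph_iff _).2 ⟨⟨_, hf⟩, h, add_right_cancel (b := f) ?_⟩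
    calc A ⟨_, hf⟩ + f = A ⟨_, hf⟩ + shiftInverse A (f + g) := congrArg _ h.symm
      _ = f + g := h3
      _ = g + f := add_comm f g

theorem shiftInverse_mem_graph (hA : IsSelfAdjoint A) (hpos : IsNonneg A) (x : H) :
    (shiftInverse A x, x - shiftInverse A x) ∈ A.graph := by
  rw [mem_graph_iff_shiftInverse hA hpos, add_sub_cancel]

theorem shiftInverse_shift (hA : IsSelfAdjoint A) (hpos : IsNonneg A) (u : A.domain) :
    shiftInverse A (shift A u) = u :=
  (shiftInverse_spec hA hpos).2 u

theorem shiftInverse_mem_domain (hA : IsSelfAdjoint A) (hpos : IsNonneg A) (x : H) :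
    shiftInverse A x ∈ A.domain :=
  LinearPMap.mem_domain_of_mem_graph (shiftInverse_mem_graph hA hpos x)

theorem shift_shiftInverse (hA : IsSelfAdjoint A) (hpos : IsNonneg A) (x : H)
    (h : shiftInverse A x ∈ A.domain) : shift A ⟨shiftInverse A x, h⟩ = x :=
  ((shiftInverse_spec hA hpos).1 x).2

theorem IsSelfAdjoint.inner_symm (hA : IsSelfAdjoint A) {f g f' g' : H} (h : (f, g) ∈ A.graph)
    (h' : (f', g') ∈ A.graph) : inner ℂ g f' = inner ℂ f g' := by
  have h1 : (f, g) ∈ A.adjoint.graph := by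
    rw [LinearPMap.isSelfAdjoint_def.1 hA]
    exact h
  exact (mem_graph_adjoint hA.dense_domain).1 h1 _ _ h'

theorem shiftInverse_symm (hA : IsSelfAdjoint A) (hpos : IsNonneg A) (x y : H) :
    inner ℂ (shiftInverse A x) y = inner ℂ x (shiftInverse A y) := by
  have h := IsSelfAdjoint.inner_symm hA (shiftInverse_mem_graph hA hpos x)
    (shiftInverse_mem_graph hA hpos y)
  rw [inner_sub_left, inner_sub_right] at h
  exact (sub_left_injective h).symm

theorem shiftInverse_nonneg (hA : IsSelfAdjoint A) (hpos : IsNonneg A) : 0 ≤ shiftInverse A := by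
  rw [ContinuousLinearMap.nonneg_iff_isPositive, ContinuousLinearMap.isPositive_def]
  refine ⟨shiftInverse_symm hA hpos, fun x => ?_⟩
  obtain ⟨y, h1, h2⟩ := (LinearPMap.mem_graph_iff _).1 (shiftInverse_mem_graph hA hpos x)
  have h3 := hpos y
  rw [h1, h2, inner_sub_right, Complex.sub_re] at h3
  have h4 : 0 ≤ (inner ℂ (shiftInverse A x) (shiftInverse A x)).re :=
    inner_self_nonneg (𝕜 := ℂ)
  change 0 ≤ (inner ℂ (shiftInverse A x) x).re
  linarith

theorem sqrtShiftInverse_symm (A : H →ₗ.[ℂ] H) (x y : H) :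
    inner ℂ (sqrtShiftInverse A x) y = inner ℂ x (sqrtShiftInverse A y) := by
  have h : 0 ≤ sqrtShiftInverse A := CFC.sqrt_nonneg _
  rw [ContinuousLinearMap.nonneg_iff_isPositive] at h
  exact h.inner_left_eq_inner_right x y

theorem sqrtShiftInverse_sq (hA : IsSelfAdjoint A) (hpos : IsNonneg A) (x : H) :
    sqrtShiftInverse A (sqrtShiftInverse A x) = shiftInverse A x :=
  DFunLike.congr_fun (CFC.sqrt_mul_sqrt_self _ (shiftInverse_nonneg hA hpos)) x

theorem shiftInverse_injective (hA : IsSelfAdjoint A) (hpos : IsNonneg A) :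
    Function.Injective (shiftInverse A) := by
  refine (injective_iff_map_eq_zero _).2 fun x hx => ?_
  have h := shiftInverse_mem_graph hA hpos x
  rw [hx, sub_zero] at h
  exact A.graph_fst_eq_zero_snd h rfl

theorem sqrtShiftInverse_injective (hA : IsSelfAdjoint A) (hpos : IsNonneg A) :
    Function.Injective (sqrtShiftInverse A) := by
  intro x y h
  apply shiftInverse_injective hA hpos
  rw [← sqrtShiftInverse_sq hA hpos, h, sqrtShiftInverse_sq hA hpos]

theorem mem_spaceOne {f : H} : f ∈ spaceOne A ↔ ∃ z, sqrtShiftInverse A z = f := by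
  rw [spaceOne, sqrtShift, LinearPMap.inverse_domain]
  constructor
  · rintro ⟨z, hz⟩
    exact ⟨z, hz⟩
  · rintro ⟨z, hz⟩
    exact ⟨⟨z, trivial⟩, hz⟩

theorem sqrtShift_apply (hA : IsSelfAdjoint A) (hpos : IsNonneg A) {f z : H}
    (hf : f ∈ (sqrtShift A).domain) (hz : sqrtShiftInverse A z = f) : sqrtShift A ⟨f, hf⟩ = z := by
  have h1 := (sqrtShift A).mem_graph ⟨f, hf⟩
  -- The graph of `LinearPMap.inverse` is the flipped graph only when the kernel is trivial.
  have hk : LinearMap.ker (((sqrtShiftInverse A : H →L[ℂ] H) : H →ₗ[ℂ] H).toPMap ⊤).toFun = ⊥ := by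
    refine (Submodule.eq_bot_iff _).2 fun x hx => Subtype.ext ?_
    exact sqrtShiftInverse_injective hA hpos (hx.trans (map_zero _).symm)
  have h2 : (f, z) ∈ (sqrtShift A).graph := by
    rw [sqrtShift, LinearPMap.inverse_graph hk]
    refine ⟨(z, f), ?_, rfl⟩
    exact (LinearPMap.mem_graph_iff _).2 ⟨⟨z, trivial⟩, rfl, hz⟩
  exact (sqrtShift A).mem_graph_snd_inj h1 h2 rfl

theorem extResolvent_coe (x : Renormed (shiftInverse A)) :
    extResolvent A (x : MinusTwo A) = renormedMap (shiftInverse A) x :=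
  ContinuousLinearMap.extend_eq _ (UniformSpace.Completion.denseRange_coe)
    (UniformSpace.Completion.isUniformInducing_coe _) x

theorem extResolvent_incl (v : H) : extResolvent A (incl A v) = shiftInverse A v :=
  extResolvent_coe _

theorem norm_extResolvent (χ : MinusTwo A) : ‖extResolvent A χ‖ = ‖χ‖ := by
  induction χ using UniformSpace.Completion.induction_on with
  | hp => exact isClosed_eq (by fun_prop) continuous_norm
  | ih x =>
    rw [extResolvent_coe, UniformSpace.Completion.norm_coe]
    rfl

theorem extResolvent_injective (A : H →ₗ.[ℂ] H) : Function.Injective (extResolvent A) := by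
  refine (injective_iff_map_eq_zero _).2 fun x hx => ?_
  rw [← norm_eq_zero, ← norm_extResolvent, hx, norm_zero]

/-- The operator G^{1/2} extends to a continuous map E from 𝓗₋₁ to the Hilbert space, and G =
G^{1/2} E holds on a dense set, hence everywhere. So elements of 𝓗₋₁ are sent into 𝓗₁. -/
theorem exists_sqrtShiftInverse_eq (hA : IsSelfAdjoint A) (hpos : IsNonneg A) {χ : MinusTwo A}
    (h : χ ∈ Set.range (inclMinusOne A)) : ∃ z, sqrtShiftInverse A z = extResolvent A χ := by
  obtain ⟨φ, rfl⟩ := h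
  have huc : UniformContinuous (fun x : Renormed (sqrtShiftInverse A) =>
      toRenormed (shiftInverse A) ((toRenormed (sqrtShiftInverse A)).symm x)) :=
    uniformContinuous_renormed LinearMap.id ‖sqrtShiftInverse A‖ fun x => by
      rw [LinearMap.id_apply, ← sqrtShiftInverse_sq hA hpos]
      exact (sqrtShiftInverse A).le_opNorm _
  let E : MinusOne A →L[ℂ] H :=
    (renormedMapL (sqrtShiftInverse A)).extend UniformSpace.Completion.toComplL
  have hE : ∀ x : Renormed (sqrtShiftInverse A),
      E (x : MinusOne A) = renormedMap (sqrtShiftInverse A) x :=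
    ContinuousLinearMap.extend_eq _ (UniformSpace.Completion.denseRange_coe)
      (UniformSpace.Completion.isUniformInducing_coe _)
  refine ⟨E φ, ?_⟩
  induction φ using UniformSpace.Completion.induction_on with
  | hp =>
    refine isClosed_eq (by fun_prop) ((extResolvent A).continuous.comp ?_)
    exact UniformSpace.Completion.continuous_map
  | ih x =>
    rw [hE, inclMinusOne, UniformSpace.Completion.map_coe huc, extResolvent_coe]
    exact sqrtShiftInverse_sq hA hpos _

/-- The commutation relation between the resolvent and an intertwining unitary operator. -/
theorem Intertwines.shiftInverse_map (hA : IsSelfAdjoint A) (hpos : IsNonneg A)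
    {V : H ≃ₗᵢ[ℂ] H} {q : ℝ} (hq : q ≠ 0) (h : Intertwines V q A) (x : H) :
    shiftInverse A (V x) = (q : ℂ) • V (shiftInverse A x) +
      (1 - q : ℂ) • shiftInverse A (V (shiftInverse A x)) := by
  have h1 := (h _ _).1 (shiftInverse_mem_graph hA hpos x)
  rw [mem_graph_iff_shiftInverse hA hpos] at h1
  have hq' : (q : ℂ) ≠ 0 := by exact_mod_cast hq
  have h2 : (q : ℂ) • (V (shiftInverse A x) + ((q⁻¹ : ℝ) : ℂ) • V (x - shiftInverse A x)) =
      V x - (1 - q : ℂ) • V (shiftInverse A x) := by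
    rw [smul_add, smul_smul, Complex.ofReal_inv, mul_inv_cancel₀ hq', one_smul, map_sub]
    module
  have h3 := congrArg (fun z => (q : ℂ) • z) h1
  rw [← map_smul (shiftInverse A), h2, map_sub, map_smul] at h3
  rw [← h3]
  abel

/-- The commutation relation on the Hilbert space does two jobs: it bounds ‖G V x‖ by a multiple of
‖G x‖, so that V extends to 𝓗₋₂, and it then passes to the completion by density. -/
theorem Intertwines.extResolvent_extOperator (hA : IsSelfAdjoint A) (hpos : IsNonneg A)
    {V : H ≃ₗᵢ[ℂ] H} {q : ℝ} (hq : q ≠ 0) (h : Intertwines V q A) (χ : MinusTwo A) :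
    extResolvent A (extOperator A V χ) = (q : ℂ) • V (extResolvent A χ) +
      (1 - q : ℂ) • shiftInverse A (V (extResolvent A χ)) := by
  have huc : UniformContinuous (fun x : Renormed (shiftInverse A) =>
      toRenormed (shiftInverse A) (V ((toRenormed (shiftInverse A)).symm x))) := by
    refine uniformContinuous_renormed (V.toLinearEquiv : H →ₗ[ℂ] H)
      (‖(q : ℂ)‖ + ‖(1 - q : ℂ)‖ * ‖shiftInverse A‖) fun x => ?_
    change ‖shiftInverse A (V x)‖ ≤ _
    rw [h.shiftInverse_map hA hpos hq]
    refine (norm_add_le _ _).trans ?_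
    rw [norm_smul, norm_smul, V.norm_map, add_mul, mul_assoc]
    gcongr
    exact ((shiftInverse A).le_opNorm _).trans_eq (by rw [V.norm_map])
  induction χ using UniformSpace.Completion.induction_on with
  | hp =>
    have hV := V.continuous
    refine isClosed_eq ((extResolvent A).continuous.comp UniformSpace.Completion.continuous_map)
      (by fun_prop)
  | ih x =>
    rw [extOperator, UniformSpace.Completion.map_coe huc, extResolvent_coe, extResolvent_coe]
    exact h.shiftInverse_map hA hpos hq _

end Resolvent

/-! ### The symmetric operator, its adjoint and its Friedrichs extension -/

section Family

variable [CompleteSpace H] {A₀ : H →ₗ.[ℂ] H} {n : ℕ} {ψ : Fin n → MinusTwo A₀}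

/-- The standing assumptions: `A₀` is nonnegative and self-adjoint, and the `ψ_j` are linearly
independent with a linear span that meets `H` only in `0`. -/
structure IsSingularFamily (A₀ : H →ₗ.[ℂ] H) (ψ : Fin n → MinusTwo A₀) : Prop where
  selfAdjoint : IsSelfAdjoint A₀
  nonneg : IsNonneg A₀
  linearIndependent : LinearIndependent ℂ ψ
  disjoint : Disjoint (Submodule.span ℂ (Set.range ψ)) (LinearMap.range (incl A₀))

/-- The span of the vectors `h_j`. -/
noncomputable def defectSpan (A₀ : H →ₗ.[ℂ] H) (ψ : Fin n → MinusTwo A₀) : Submodule ℂ H :=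
  Submodule.span ℂ (Set.range (defectVec A₀ ψ))

instance : FiniteDimensional ℂ (defectSpan A₀ ψ) :=
  FiniteDimensional.span_of_finite ℂ (Set.finite_range _)

theorem defectVec_mem (j : Fin n) : defectVec A₀ ψ j ∈ defectSpan A₀ ψ :=
  Submodule.subset_span ⟨j, rfl⟩

theorem mem_defectSpan {f : H} :
    f ∈ defectSpan A₀ ψ ↔ ∃ c : Fin n → ℂ, ∑ j, c j • defectVec A₀ ψ j = f :=
  Submodule.mem_span_range_iff_exists_fun ℂ

theorem extResolvent_sum (c : Fin n → ℂ) :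
    extResolvent A₀ (∑ j, c j • ψ j) = ∑ j, c j • defectVec A₀ ψ j := by
  simp [defectVec]

theorem mem_defectSpan_orthogonal {x : H} :
    x ∈ (defectSpan A₀ ψ)ᗮ ↔ ∀ j, inner ℂ (defectVec A₀ ψ j) x = 0 := by
  refine ⟨fun h j => h _ (defectVec_mem j), fun h y hy => ?_⟩
  obtain ⟨c, rfl⟩ := mem_defectSpan.1 hy
  rw [sum_inner]
  exact Finset.sum_eq_zero fun j _ => by rw [inner_smul_left, h, mul_zero]

theorem pairing_apply (χ : MinusTwo A₀) (u : A₀.domain) :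
    pairing A₀ χ u = inner ℂ (extResolvent A₀ χ) (shift A₀ u) := rfl

theorem IsSingularFamily.linearIndependent_defectVec (h : IsSingularFamily A₀ ψ) :
    LinearIndependent ℂ (defectVec A₀ ψ) :=
  h.linearIndependent.map' (extResolvent A₀ : MinusTwo A₀ →ₗ[ℂ] H)
    (LinearMap.ker_eq_bot.2 (extResolvent_injective A₀))

/-- The extended resolvent is injective and maps the span of the ψ_j onto that of the h_j, so such
an x lies in the span of the ψ_j. Density of D(A_sym) and uniqueness of coordinates both rest on
this. -/
theorem IsSingularFamily.eq_zero_of_mem (h : IsSingularFamily A₀ ψ) {x : H}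
    (hx : shiftInverse A₀ x ∈ defectSpan A₀ ψ) : x = 0 := by
  obtain ⟨c, hc⟩ := mem_defectSpan.1 hx
  rw [← extResolvent_sum, ← extResolvent_incl] at hc
  have h1 := extResolvent_injective A₀ hc
  have h2 : incl A₀ x = 0 := by
    refine Submodule.disjoint_def.1 h.disjoint _ ?_ ⟨x, rfl⟩
    rw [← h1]
    exact Submodule.sum_mem _ fun j _ => Submodule.smul_mem _ _ (Submodule.subset_span ⟨j, rfl⟩)
  apply shiftInverse_injective h.selfAdjoint h.nonneg
  rw [← extResolvent_incl, h2, map_zero, map_zero]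

theorem IsSingularFamily.symOp_graph (h : IsSingularFamily A₀ ψ) :
    IsResolventRestriction (symOp A₀ ψ) (shiftInverse A₀) (defectSpan A₀ ψ)ᗮ := by
  intro f g
  rw [symOp, mem_graph_domRestrict, ← mem_graph_iff_shiftInverse h.selfAdjoint h.nonneg]
  refine and_congr_left fun hfg => ?_
  obtain ⟨u, rfl, rfl⟩ := (LinearPMap.mem_graph_iff _).1 hfg
  simp only [Submodule.mem_map, Submodule.mem_iInf, LinearMap.mem_ker, mem_defectSpan_orthogonal]
  constructor
  · rintro ⟨v, hv, hvu⟩ j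
    obtain rfl : v = u := Subtype.ext hvu
    have := hv j
    rwa [pairing_apply, shift_apply, add_comm] at this
  · intro hu
    refine ⟨u, fun j => ?_, rfl⟩
    rw [pairing_apply, shift_apply, add_comm]
    exact hu j

/-- A vector v orthogonal to G(𝓗ᗮ) has G v in 𝓗ᗮᗮ, which is 𝓗 by finite dimension, and then v = 0.
-/
theorem IsSingularFamily.dense_symOp (h : IsSingularFamily A₀ ψ) :
    Dense ((symOp A₀ ψ).domain : Set H) := by
  rw [Submodule.dense_iff_topologicalClosure_eq_top, Submodule.topologicalClosure_eq_top_iff,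
    Submodule.eq_bot_iff]
  intro v hv
  refine h.eq_zero_of_mem ?_
  rw [← Submodule.orthogonal_orthogonal (defectSpan A₀ ψ)]
  intro x hx
  rw [← shiftInverse_symm h.selfAdjoint h.nonneg]
  exact hv _ (LinearPMap.mem_domain_of_mem_graph (h.symOp_graph.mem_graph hx))

theorem IsSingularFamily.adjoint_graph (h : IsSingularFamily A₀ ψ) {f g : H} :
    (f, g) ∈ (symOp A₀ ψ).adjoint.graph ↔ f - shiftInverse A₀ (f + g) ∈ defectSpan A₀ ψ := by
  rw [h.symOp_graph.mem_graph_adjoint (shiftInverse_symm h.selfAdjoint h.nonneg) h.dense_symOp,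
    Submodule.orthogonal_orthogonal]

theorem IsSingularFamily.defect_eq (h : IsSingularFamily A₀ ψ) :
    defect A₀ ψ = defectSpan A₀ ψ := by
  have key : ∀ f, (f, -f) ∈ (symOp A₀ ψ).adjoint.graph ↔ f ∈ defectSpan A₀ ψ := fun f => by
    rw [h.adjoint_graph, add_neg_cancel, map_zero, sub_zero]
  ext f
  rw [← key, defect, LinearPMap.mem_graph_iff]
  simp only [Submodule.mem_map, LinearMap.mem_ker, shift_apply, add_eq_zero_iff_eq_neg]
  constructor
  · rintro ⟨y, hy, rfl⟩
    exact ⟨y, rfl, hy⟩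
  · rintro ⟨y, rfl, hy⟩
    exact ⟨y, hy, rfl⟩

theorem IsSingularFamily.symOp_nonneg (h : IsSingularFamily A₀ ψ) : IsNonneg (symOp A₀ ψ) := by
  intro x
  have hle : symOp A₀ ψ ≤ A₀ := LinearPMap.domRestrict_le
  have := h.nonneg ⟨x, hle.1 x.2⟩
  rwa [← hle.2 (x := x) rfl] at this

/-! ### The closed form of A_sym and the resolvent of A_F. -/

/-- The image of `𝓗 ∩ 𝓗₁` under `(A₀ + I)^{1/2}`. -/
noncomputable def defectRoot (A₀ : H →ₗ.[ℂ] H) (ψ : Fin n → MinusTwo A₀) : Submodule ℂ H :=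
  (defectSpan A₀ ψ).comap (sqrtShiftInverse A₀ : H →ₗ[ℂ] H)

theorem mem_defectRoot {v : H} :
    v ∈ defectRoot A₀ ψ ↔ sqrtShiftInverse A₀ v ∈ defectSpan A₀ ψ := Iff.rfl

theorem IsSingularFamily.finiteDimensional_defectRoot (h : IsSingularFamily A₀ ψ) :
    FiniteDimensional ℂ (defectRoot A₀ ψ) := by
  let T : defectRoot A₀ ψ →ₗ[ℂ] defectSpan A₀ ψ :=
    (sqrtShiftInverse A₀ : H →ₗ[ℂ] H).restrict fun v hv => hv
  refine FiniteDimensional.of_injective T fun v w hvw => Subtype.ext ?_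
  exact sqrtShiftInverse_injective h.selfAdjoint h.nonneg (congrArg Subtype.val hvw)

theorem IsSingularFamily.defectRoot_orthogonal_orthogonal (h : IsSingularFamily A₀ ψ) :
    (defectRoot A₀ ψ)ᗮᗮ = defectRoot A₀ ψ := by
  have := h.finiteDimensional_defectRoot
  exact Submodule.orthogonal_orthogonal _

theorem norm_sqrtShiftInverse_le (hA : IsSelfAdjoint A₀) (hpos : IsNonneg A₀) (w : H) :
    ‖sqrtShiftInverse A₀ w‖ ≤ ‖w‖ := by
  have h1 : ‖shiftInverse A₀ w‖ ≤ ‖w‖ := by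
    have h2 := norm_le_norm_shift hpos ⟨_, shiftInverse_mem_domain hA hpos w⟩
    rwa [shift_shiftInverse hA hpos] at h2
  have h3 : ‖sqrtShiftInverse A₀ w‖ ^ 2 ≤ ‖w‖ * ‖shiftInverse A₀ w‖ := by
    rw [← inner_self_eq_norm_sq (𝕜 := ℂ), sqrtShiftInverse_symm, sqrtShiftInverse_sq hA hpos]
    exact re_inner_le_norm _ _
  refine abs_le_of_sq_le_sq' (h3.trans ?_) (norm_nonneg _) |>.2
  rw [sq]
  gcongr

/-- The form norm of `A_sym`, in terms of `(A₀ + I)^{1/2}`. -/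
theorem IsSingularFamily.norm_sq_sqrtShiftInverse (h : IsSingularFamily A₀ ψ)
    (u : (symOp A₀ ψ).domain) {x : H} (hx : (u : H) = shiftInverse A₀ x)
    (hx' : symOp A₀ ψ u = x - shiftInverse A₀ x) :
    ‖sqrtShiftInverse A₀ x‖ ^ 2 = (inner ℂ (u : H) (symOp A₀ ψ u)).re + ‖(u : H)‖ ^ 2 := by
  have h1 : (inner ℂ (u : H) (u : H)).re = ‖(u : H)‖ ^ 2 := inner_self_eq_norm_sq (𝕜 := ℂ) _
  have h2 : (inner ℂ (sqrtShiftInverse A₀ x) (sqrtShiftInverse A₀ x)).re =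
    ‖sqrtShiftInverse A₀ x‖ ^ 2 := inner_self_eq_norm_sq (𝕜 := ℂ) _
  rw [← h1, ← Complex.add_re, ← inner_add_right, hx', ← h2, sqrtShiftInverse_symm,
    sqrtShiftInverse_sq h.selfAdjoint h.nonneg, hx, sub_add_cancel,
    shiftInverse_symm h.selfAdjoint h.nonneg]

/-- Identifies the closure of G^{1/2}(𝓗ᗮ) with Lᗮ once orthogonal complements are taken again. -/
theorem map_orthogonal_orthogonal (A₀ : H →ₗ.[ℂ] H) (ψ : Fin n → MinusTwo A₀) :
    (((defectSpan A₀ ψ)ᗮ).map (sqrtShiftInverse A₀ : H →ₗ[ℂ] H))ᗮ = defectRoot A₀ ψ := by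
  ext v
  have h0 : v ∈ defectRoot A₀ ψ ↔ sqrtShiftInverse A₀ v ∈ (defectSpan A₀ ψ)ᗮᗮ := by
    rw [mem_defectRoot, Submodule.orthogonal_orthogonal]
  rw [h0, Submodule.mem_orthogonal, Submodule.mem_orthogonal]
  constructor
  · intro hv x hx
    rw [← sqrtShiftInverse_symm]
    exact hv _ ⟨x, hx, rfl⟩
  · rintro hv _ ⟨x, hx, rfl⟩
    exact (sqrtShiftInverse_symm A₀ x v).trans (hv x hx)

/-- For u = G x the form norm (A_sym u, u) + ‖u‖² equals ‖G^{1/2} x‖². Closing the form thus amounts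
to closing G^{1/2}(𝓗ᗮ) in norm, and G^{1/2} carries this closure onto the form domain. -/
theorem IsSingularFamily.mem_formDomain (h : IsSingularFamily A₀ ψ) {f : H} :
    f ∈ formDomain (symOp A₀ ψ) ↔ ∃ z ∈ (defectRoot A₀ ψ)ᗮ, sqrtShiftInverse A₀ z = f := by
  rw [SingPert.mem_formDomain h.symOp_nonneg, ← map_orthogonal_orthogonal,
    Submodule.orthogonal_orthogonal_eq_closure]
  constructor
  · rintro ⟨u, hu, hu'⟩
    choose x hxm hx hx' using fun k => h.symOp_graph.exists_eq (u k)
    have hc : CauchySeq fun k => sqrtShiftInverse A₀ (x k) := by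
      rw [cauchySeq_iff_tendsto_dist_atTop_0]
      have hd : Tendsto (fun m : ℕ × ℕ => ‖((u m.1 - u m.2 : (symOp A₀ ψ).domain) : H)‖ ^ 2)
          atTop (𝓝 0) := by
        have := (cauchySeq_iff_tendsto_dist_atTop_0.1 hu.cauchySeq).pow 2
        simpa [dist_eq_norm] using this
      have hs := (Tendsto.add hu' hd).sqrt
      rw [add_zero, Real.sqrt_zero] at hs
      refine hs.congr fun m => ?_
      rw [dist_eq_norm, ← map_sub, ← h.norm_sq_sqrtShiftInverse (u m.1 - u m.2)
        (x := x m.1 - x m.2), Real.sqrt_sq (norm_nonneg _)]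
      · rw [Submodule.coe_sub, hx, hx, map_sub]
      · rw [LinearPMap.map_sub, hx', hx', map_sub]
        abel
    obtain ⟨z, hz⟩ := cauchySeq_tendsto_of_complete hc
    refine ⟨z, mem_closure_of_tendsto hz (Eventually.of_forall fun k => ⟨x k, hxm k, rfl⟩), ?_⟩
    refine tendsto_nhds_unique (((sqrtShiftInverse A₀).continuous.tendsto z).comp hz) ?_
    refine hu.congr fun k => ?_
    rw [hx, Function.comp_apply, sqrtShiftInverse_sq h.selfAdjoint h.nonneg]
  · rintro ⟨z, hz, rfl⟩
    obtain ⟨y, hy, hyz⟩ := mem_closure_iff_seq_limit.1 hz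
    choose x hxm hx using hy
    have hu : ∀ k, ∃ u : (symOp A₀ ψ).domain, (u : H) = shiftInverse A₀ (x k) ∧
        symOp A₀ ψ u = x k - shiftInverse A₀ (x k) := fun k =>
      (LinearPMap.mem_graph_iff _).1 (h.symOp_graph.mem_graph (hxm k))
    choose u hu hu' using hu
    have hx2 : ∀ k, sqrtShiftInverse A₀ (x k) = y k := hx
    refine ⟨u, ?_, ?_⟩
    · refine (((sqrtShiftInverse A₀).continuous.tendsto z).comp hyz).congr fun k => ?_
      rw [hu, Function.comp_apply, ← hx2, sqrtShiftInverse_sq h.selfAdjoint h.nonneg]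
    · have h1 := (cauchySeq_iff_tendsto_dist_atTop_0.1 hyz.cauchySeq).pow 2
      rw [zero_pow two_ne_zero] at h1
      refine squeeze_zero (fun m => h.symOp_nonneg _) (fun m => ?_) h1
      have h2 := h.norm_sq_sqrtShiftInverse (u m.1 - u m.2) (x := x m.1 - x m.2)
        (by rw [Submodule.coe_sub, hu, hu, map_sub])
        (by rw [LinearPMap.map_sub, hu', hu', map_sub]; abel)
      rw [map_sub, hx2, hx2, ← dist_eq_norm] at h2
      rw [h2]
      exact le_add_of_nonneg_right (sq_nonneg _)

/-- The resolvent `(A_F + I)⁻¹` of the Friedrichs extension of `A_sym`. -/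
noncomputable def friedrichsResolvent (A₀ : H →ₗ.[ℂ] H) (ψ : Fin n → MinusTwo A₀) : H →L[ℂ] H :=
  sqrtShiftInverse A₀ ∘L ((defectRoot A₀ ψ)ᗮ).starProjection ∘L sqrtShiftInverse A₀

theorem friedrichsResolvent_apply (x : H) : friedrichsResolvent A₀ ψ x =
    sqrtShiftInverse A₀ (((defectRoot A₀ ψ)ᗮ).starProjection (sqrtShiftInverse A₀ x)) := rfl

theorem friedrichsResolvent_symm (x y : H) :
    inner ℂ (friedrichsResolvent A₀ ψ x) y = inner ℂ x (friedrichsResolvent A₀ ψ y) := by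
  rw [friedrichsResolvent_apply, friedrichsResolvent_apply, sqrtShiftInverse_symm,
    Submodule.inner_starProjection_left_eq_right, sqrtShiftInverse_symm]

/-- The difference is G^{1/2} (I - P) G^{1/2}, and I - P projects onto L, which G^{1/2} maps onto
𝓗'. The next lemma bounds its kernel by the orthogonal complement of 𝓗'. -/
theorem IsSingularFamily.shiftInverse_sub_friedrichsResolvent_mem (h : IsSingularFamily A₀ ψ)
    (x : H) : shiftInverse A₀ x - friedrichsResolvent A₀ ψ x ∈ defectSpan A₀ ψ ⊓ spaceOne A₀ := by
  rw [friedrichsResolvent_apply, ← sqrtShiftInverse_sq h.selfAdjoint h.nonneg, ← map_sub]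
  exact ⟨h.defectRoot_orthogonal_orthogonal.le (Submodule.sub_starProjection_mem_orthogonal _),
    mem_spaceOne.2 ⟨_, rfl⟩⟩

theorem IsSingularFamily.mem_orthogonal_of_shiftInverse_eq (h : IsSingularFamily A₀ ψ) {x : H}
    (hx : shiftInverse A₀ x = friedrichsResolvent A₀ ψ x) :
    x ∈ (defectSpan A₀ ψ ⊓ spaceOne A₀)ᗮ := by
  rw [friedrichsResolvent_apply, ← sqrtShiftInverse_sq h.selfAdjoint h.nonneg] at hx
  have h1 := sqrtShiftInverse_injective h.selfAdjoint h.nonneg hx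
  rintro v ⟨hv, hv'⟩
  obtain ⟨l, rfl⟩ := mem_spaceOne.1 hv'
  rw [sqrtShiftInverse_symm, h1]
  exact (Submodule.starProjection_apply_mem (defectRoot A₀ ψ)ᗮ _) l hv

/-- Put f = G^{1/2} z with z ∈ Lᗮ and y = G^{1/2}(f + g). Membership in A_sym* says G^{1/2}(z - y) ∈
𝓗, that is z - y ∈ L, so z is the projection of y onto Lᗮ. -/
theorem IsSingularFamily.friedrichs_graph (h : IsSingularFamily A₀ ψ) :
    IsResolventRestriction (friedrichs (symOp A₀ ψ)) (friedrichsResolvent A₀ ψ) ⊤ := by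
  intro f g
  rw [mem_graph_friedrichs, h.adjoint_graph, h.mem_formDomain, friedrichsResolvent_apply,
    ← sqrtShiftInverse_sq h.selfAdjoint h.nonneg]
  set L := defectRoot A₀ ψ
  set y := sqrtShiftInverse A₀ (f + g)
  constructor
  · rintro ⟨h1, z, hz, rfl⟩
    refine ⟨trivial, ?_⟩
    rw [← map_sub, ← mem_defectRoot, ← h.defectRoot_orthogonal_orthogonal] at h1
    have h2 := (Submodule.starProjection_apply_eq_zero_iff Lᗮ).2 h1
    rw [map_sub, Submodule.starProjection_eq_self_iff.2 hz] at h2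
    rw [← sub_eq_zero.1 h2]
  · rintro ⟨-, h1⟩
    refine ⟨?_, _, Submodule.starProjection_apply_mem _ _, h1⟩
    rw [← h1, ← map_sub, ← mem_defectRoot, ← h.defectRoot_orthogonal_orthogonal, ← neg_mem_iff,
      neg_sub]
    exact Submodule.sub_starProjection_mem_orthogonal _

theorem IsSingularFamily.friedrichsResolvent_eq (h : IsSingularFamily A₀ ψ) {x : H}
    (hx : x ∈ (defectSpan A₀ ψ)ᗮ) : friedrichsResolvent A₀ ψ x = shiftInverse A₀ x := by
  rw [friedrichsResolvent_apply, Submodule.starProjection_eq_self_iff.2,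
    sqrtShiftInverse_sq h.selfAdjoint h.nonneg]
  intro l hl
  rw [← sqrtShiftInverse_symm]
  exact hx _ hl

/-! ### The intermediate operator S and its adjoint. -/

variable {K : Submodule ℂ H}

theorem IsSingularFamily.range_shift_symOp (h : IsSingularFamily A₀ ψ) :
    LinearMap.range (shift (symOp A₀ ψ)) = (defectSpan A₀ ψ)ᗮ := by
  ext x
  constructor
  · rintro ⟨u, rfl⟩
    rw [shift_apply, add_comm]
    exact ((h.symOp_graph _ _).1 ((symOp A₀ ψ).mem_graph u)).1
  · intro hx
    obtain ⟨u, hu, hu'⟩ := (LinearPMap.mem_graph_iff _).1 (h.symOp_graph.mem_graph hx)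
    exact ⟨u, by rw [shift_apply, hu, hu', sub_add_cancel]⟩

theorem IsSingularFamily.intermediateOp_graph (h : IsSingularFamily A₀ ψ) :
    IsResolventRestriction (intermediateOp A₀ ψ K) (friedrichsResolvent A₀ ψ)
      ((defectSpan A₀ ψ)ᗮ ⊔ K) := by
  intro f g
  rw [intermediateOp, mem_graph_domRestrict, h.range_shift_symOp]
  have h1 := h.friedrichs_graph f g
  rw [and_iff_right Submodule.mem_top] at h1
  rw [← h1]
  refine and_congr_left fun hfg => ?_
  obtain ⟨u, rfl, rfl⟩ := (LinearPMap.mem_graph_iff _).1 hfg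
  rw [Submodule.mem_map]
  constructor
  · rintro ⟨v, hv, hvu⟩
    obtain rfl : v = u := Subtype.ext hvu
    rwa [Submodule.mem_comap, shift_apply, add_comm] at hv
  · intro hu
    refine ⟨u, ?_, rfl⟩
    rwa [Submodule.mem_comap, shift_apply, add_comm]

theorem IsSingularFamily.symOp_le (h : IsSingularFamily A₀ ψ) :
    symOp A₀ ψ ≤ intermediateOp A₀ ψ K := by
  refine LinearPMap.le_of_le_graph ?_
  rintro ⟨f, g⟩ hfg
  obtain ⟨h1, h2⟩ := (h.symOp_graph f g).1 hfg
  rw [h.intermediateOp_graph, h.friedrichsResolvent_eq h1]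
  exact ⟨Submodule.mem_sup_left h1, h2⟩

theorem IsSingularFamily.dense_intermediateOp (h : IsSingularFamily A₀ ψ) :
    Dense ((intermediateOp A₀ ψ K).domain : Set H) :=
  h.dense_symOp.mono h.symOp_le.1

/-- With w = P G^{1/2} x the form equals ‖w‖² - ‖G^{1/2} w‖², and G^{1/2} is a contraction. -/
theorem IsSingularFamily.intermediateOp_nonneg (h : IsSingularFamily A₀ ψ) :
    IsNonneg (intermediateOp A₀ ψ K) := by
  intro u
  obtain ⟨x, -, hx, hx'⟩ := h.intermediateOp_graph.exists_eq u
  set w := ((defectRoot A₀ ψ)ᗮ).starProjection (sqrtShiftInverse A₀ x) with hw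
  have h1 : friedrichsResolvent A₀ ψ x = sqrtShiftInverse A₀ w := rfl
  have h2 : (inner ℂ (sqrtShiftInverse A₀ w) (sqrtShiftInverse A₀ w)).re =
    ‖sqrtShiftInverse A₀ w‖ ^ 2 := inner_self_eq_norm_sq (𝕜 := ℂ) _
  have h3 : (inner ℂ (sqrtShiftInverse A₀ w) x).re = ‖w‖ ^ 2 := by
    rw [sqrtShiftInverse_symm, hw]
    exact Submodule.re_inner_starProjection_eq_normSq (defectRoot A₀ ψ)ᗮ (sqrtShiftInverse A₀ x)
  rw [hx', hx, inner_sub_right, Complex.sub_re, h1, h2, h3, sub_nonneg]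
  gcongr
  exact norm_sqrtShiftInverse_le h.selfAdjoint h.nonneg w

theorem IsSingularFamily.intermediateOp_isSymm (h : IsSingularFamily A₀ ψ) :
    IsSymm (intermediateOp A₀ ψ K) :=
  h.intermediateOp_graph.isSymm friedrichsResolvent_symm

theorem IsSingularFamily.intermediateOp_adjoint_graph (h : IsSingularFamily A₀ ψ) {f g : H} :
    (f, g) ∈ (intermediateOp A₀ ψ K).adjoint.graph ↔
      f - friedrichsResolvent A₀ ψ (f + g) ∈ defectSpan A₀ ψ ⊓ Kᗮ := by
  rw [h.intermediateOp_graph.mem_graph_adjoint friedrichsResolvent_symm h.dense_intermediateOp,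
    ← Submodule.inf_orthogonal, Submodule.orthogonal_orthogonal]

theorem IsSingularFamily.intermediateOp_adjoint_le (h : IsSingularFamily A₀ ψ) {f g : H}
    (hfg : (f, g) ∈ (intermediateOp A₀ ψ K).adjoint.graph) :
    (f, g) ∈ (symOp A₀ ψ).adjoint.graph := by
  rw [mem_graph_adjoint h.dense_intermediateOp] at hfg
  rw [mem_graph_adjoint h.dense_symOp]
  exact fun u v huv => hfg u v (LinearPMap.le_graph_of_le h.symOp_le huv)

/-- Transversality of the extremal extensions of `A_sym` is inherited by `S`. -/
theorem IsSingularFamily.exists_friedrichs_add_kreinVonNeumann (h : IsSingularFamily A₀ ψ)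
    (hFN : Transversal (symOp A₀ ψ) (friedrichs (symOp A₀ ψ)) (kreinVonNeumann (symOp A₀ ψ)))
    {k : H} (hk : k ∈ defectSpan A₀ ψ ⊓ Kᗮ) :
    ∃ y f g, k = friedrichsResolvent A₀ ψ y + f ∧
      (f, g) ∈ (kreinVonNeumann (intermediateOp A₀ ψ K)).graph := by
  have hkA : (k, -k) ∈ (symOp A₀ ψ).adjoint.graph := by
    rw [h.adjoint_graph, add_neg_cancel, map_zero, sub_zero]
    exact hk.1
  have hkd := LinearPMap.mem_domain_of_mem_graph hkA
  rw [← hFN] at hkd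
  obtain ⟨f₁, hf₁, f₂, hf₂, hkf⟩ := Submodule.mem_sup.1 hkd
  obtain ⟨g₁, h1⟩ := LinearPMap.mem_domain_iff.1 hf₁
  obtain ⟨g₂, h2⟩ := LinearPMap.mem_domain_iff.1 hf₂
  have h3 := mem_graph_kreinVonNeumann.1 h2
  have hg : g₁ + g₂ = -k := (symOp A₀ ψ).adjoint.mem_graph_snd_inj
    (Submodule.add_mem _ (mem_graph_friedrichs.1 h1).1 h3.1) hkA hkf
  obtain ⟨-, h4⟩ := (h.friedrichs_graph _ _).1 h1
  refine ⟨f₁ + g₁, f₂, g₂, by rw [h4, hkf], mem_graph_kreinVonNeumann.2 ⟨?_,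
    formRange_mono h.symOp_nonneg h.symOp_le h3.2⟩⟩
  rw [h.intermediateOp_adjoint_graph]
  -- Since A_sym* k = -k, the sums f₁ + g₁ and f₂ + g₂ cancel. Hence f₂ - G_F(f₂ + g₂) = f₂ + f₁ =
  -- k, which is exactly the condition for (f₂, g₂) to be in the graph of S*.
  have h5 : f₂ + g₂ = -(f₁ + g₁) := by
    rw [eq_neg_iff_add_eq_zero, add_add_add_comm, add_comm f₂, hkf, add_comm g₂, hg,
      add_neg_cancel]
  rw [h5, map_neg, h4, sub_neg_eq_add, add_comm, hkf]
  exact hk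

end Family

/-! ### A finite-dimensional lemma -/

section FiniteDimensional

variable {D D' K : Submodule ℂ H} [FiniteDimensional ℂ D]

/-- By dimension count D is the sum of K and D ⊖ D'. A vector of D' ∩ Kᗮ is orthogonal to both
summands, hence to itself. -/
theorem inf_orthogonal_eq_bot_of_finrank_eq (hD' : D' ≤ D) (hK : K ≤ D)
    (hdim : Module.finrank ℂ K = Module.finrank ℂ D') (hint : K ⊓ (D ⊓ D'ᗮ) = ⊥) :
    D' ⊓ Kᗮ = ⊥ := by
  have hfd := Submodule.finiteDimensional_of_le hD'
  have hfK := Submodule.finiteDimensional_of_le hK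
  have hf'' : FiniteDimensional ℂ (D ⊓ D'ᗮ : Submodule ℂ H) :=
    Submodule.finiteDimensional_of_le inf_le_left
  have h1 := Submodule.finrank_add_inf_finrank_orthogonal hD'
  have h2 := Submodule.finrank_sup_add_finrank_inf_eq K (D ⊓ D'ᗮ)
  rw [inf_comm] at h1
  rw [hint, finrank_bot, add_zero, hdim, h1] at h2
  have h3 : K ⊔ (D ⊓ D'ᗮ) = D := Submodule.eq_of_le_of_finrank_eq (sup_le hK inf_le_left) h2
  refine (Submodule.eq_bot_iff _).2 fun x hx => ?_
  obtain ⟨k, hk, d, hd, hkd⟩ := Submodule.mem_sup.1 (h3.ge (hD' hx.1))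
  have h4 : inner ℂ (k + d) x = 0 := by
    rw [inner_add_left, hx.2 k hk, Submodule.inner_left_of_mem_orthogonal hx.1 hd.2, add_zero]
  rwa [hkd, inner_self_eq_zero] at h4

theorem sup_orthogonal_eq_of_finrank_eq (hD' : D' ≤ D) (hK : K ≤ D)
    (hdim : Module.finrank ℂ K = Module.finrank ℂ D') (hint : K ⊓ (D ⊓ D'ᗮ) = ⊥) :
    D' ⊔ (D ⊓ Kᗮ) = D := by
  have hfd := Submodule.finiteDimensional_of_le hD'
  have hfK := Submodule.finiteDimensional_of_le hK
  have hf'' : FiniteDimensional ℂ (D ⊓ Kᗮ : Submodule ℂ H) :=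
    Submodule.finiteDimensional_of_le inf_le_left
  have h1 := Submodule.finrank_add_inf_finrank_orthogonal hK
  have h2 := Submodule.finrank_sup_add_finrank_inf_eq D' (D ⊓ Kᗮ)
  have h3 : D' ⊓ (D ⊓ Kᗮ) = ⊥ := by
    rw [← inf_assoc, inf_eq_left.2 hD', inf_orthogonal_eq_bot_of_finrank_eq hD' hK hdim hint]
  rw [inf_comm] at h1
  rw [h3, finrank_bot, add_zero, ← hdim, h1] at h2
  exact Submodule.eq_of_le_of_finrank_eq (sup_le hD' inf_le_left) h2

end FiniteDimensional

/-- Prescribed inner products with finitely many linearly independent vectors. -/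
theorem exists_inner_eq {ι : Type*} [Finite ι] {v : ι → H}
    (hv : LinearIndependent ℂ v) (c : ι → ℂ) : ∃ y, ∀ i, inner ℂ (v i) y = c i := by
  have : FiniteDimensional ℂ (Submodule.span ℂ (Set.range v)) :=
    FiniteDimensional.span_of_finite ℂ (Set.finite_range v)
  have : CompleteSpace (Submodule.span ℂ (Set.range v)) := FiniteDimensional.complete ℂ _
  let b := Module.Basis.span hv
  let φ : Submodule.span ℂ (Set.range v) →ₗ[ℂ] ℂ := b.constr ℂ fun i => starRingEnd ℂ (c i)
  refine ⟨((InnerProductSpace.toDual ℂ (Submodule.span ℂ (Set.range v))).symm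
    (LinearMap.toContinuousLinearMap φ) : Submodule.span ℂ (Set.range v)), fun i => ?_⟩
  have h1 := InnerProductSpace.toDual_symm_apply (𝕜 := ℂ) (x := b i)
    (y := LinearMap.toContinuousLinearMap φ)
  have h2 : (LinearMap.toContinuousLinearMap φ) (b i) = starRingEnd ℂ (c i) :=
    b.constr_basis ℂ _ i
  rw [h2, Submodule.coe_inner, Module.Basis.span_apply] at h1
  rw [← inner_conj_symm, h1, Complex.conj_conj]

/-! ### Matrix parametrization -/

section Family

variable [CompleteSpace H] {A₀ : H →ₗ.[ℂ] H} {n : ℕ} {ψ : Fin n → MinusTwo A₀}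

theorem assemble_apply (w : A₀.domain × (Fin n → ℂ)) :
    assemble A₀ ψ w = (w.1 : H) + ∑ p, w.2 p • defectVec A₀ ψ p := by
  simp [assemble, Fintype.linearCombination_apply]

theorem extFunctional_apply (R : Matrix (Fin n) (Fin n) ℂ) (j : Fin n)
    (w : A₀.domain × (Fin n → ℂ)) : extFunctional A₀ ψ R j w =
      inner ℂ (defectVec A₀ ψ j) (shift A₀ w.1) + ∑ p, R j p * w.2 p := by
  simp [extFunctional, Fintype.linearCombination_apply, pairing_apply, defectVec, mul_comm]

theorem mem_graph_matrixOp {R : Matrix (Fin n) (Fin n) ℂ} {f g : H} :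
    (f, g) ∈ (matrixOp A₀ ψ R).graph ↔
      (∃ w, (∀ j, extFunctional A₀ ψ R j w = 0) ∧ assemble A₀ ψ w = f) ∧
        (f, g) ∈ (symOp A₀ ψ).adjoint.graph := by
  rw [matrixOp, mem_graph_domRestrict]
  simp only [Submodule.mem_map, Submodule.mem_iInf, LinearMap.mem_ker]

theorem sum_smul_defectVec_mem (α : Fin n → ℂ) :
    ∑ p, α p • defectVec A₀ ψ p ∈ defectSpan A₀ ψ :=
  mem_defectSpan.2 ⟨α, rfl⟩

theorem IsSingularFamily.mem_adjoint_graph (h : IsSingularFamily A₀ ψ) (y : H) {k : H}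
    (hk : k ∈ defectSpan A₀ ψ) : (shiftInverse A₀ y + k, y - (shiftInverse A₀ y + k)) ∈
      (symOp A₀ ψ).adjoint.graph := by
  rw [h.adjoint_graph, add_sub_cancel, add_sub_cancel_left]
  exact hk

/-- The coordinates in `D(A_sym*) = D(A₀) ∔ 𝓗` are unique. -/
theorem IsSingularFamily.coord_unique (h : IsSingularFamily A₀ ψ) {y y' : H} {α α' : Fin n → ℂ}
    (he : shiftInverse A₀ y + ∑ p, α p • defectVec A₀ ψ p =
      shiftInverse A₀ y' + ∑ p, α' p • defectVec A₀ ψ p) : y = y' ∧ α = α' := by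
  have h1 : y - y' = 0 := by
    refine h.eq_zero_of_mem ?_
    rw [map_sub, sub_eq_sub_iff_add_eq_add.2 (he.trans (add_comm _ _))]
    exact sub_mem (sum_smul_defectVec_mem _) (sum_smul_defectVec_mem _)
  obtain rfl := sub_eq_zero.1 h1
  refine ⟨rfl, funext fun i => sub_eq_zero.1 ?_⟩
  refine Fintype.linearIndependent_iff.1 h.linearIndependent_defectVec (fun i => α i - α' i) ?_ i
  simp_rw [sub_smul]
  rw [Finset.sum_sub_distrib, add_left_cancel he, sub_self]

theorem IsSingularFamily.mem_domain_matrixOp (h : IsSingularFamily A₀ ψ)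
    {R : Matrix (Fin n) (Fin n) ℂ} {y : H} {α : Fin n → ℂ} :
    shiftInverse A₀ y + ∑ p, α p • defectVec A₀ ψ p ∈ (matrixOp A₀ ψ R).domain ↔
      ∀ i, inner ℂ (defectVec A₀ ψ i) y + ∑ p, R i p * α p = 0 := by
  have hy := shiftInverse_mem_domain h.selfAdjoint h.nonneg y
  rw [LinearPMap.mem_domain_iff]
  constructor
  · rintro ⟨g, hg⟩ i
    obtain ⟨⟨w, hw, hwf⟩, -⟩ := mem_graph_matrixOp.1 hg
    rw [assemble_apply, ← shiftInverse_shift h.selfAdjoint h.nonneg] at hwf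
    obtain ⟨rfl, rfl⟩ := h.coord_unique hwf
    rw [← extFunctional_apply]
    exact hw i
  · intro hα
    refine ⟨_, mem_graph_matrixOp.2 ⟨⟨(⟨_, hy⟩, α), fun j => ?_, assemble_apply _⟩,
      h.mem_adjoint_graph y (sum_smul_defectVec_mem α)⟩⟩
    rw [extFunctional_apply, shift_shiftInverse h.selfAdjoint h.nonneg]
    exact hα j

/-- A symmetric extension `N` of `A_sym` with `D(N) + D(A₀) = D(A_sym*)` comes from a Hermitian
matrix. -/
theorem IsSingularFamily.exists_eq_matrixOp (h : IsSingularFamily A₀ ψ) {N : H →ₗ.[ℂ] H}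
    (hle : symOp A₀ ψ ≤ N)
    (hadj : ∀ f g, (f, g) ∈ N.graph → (f, g) ∈ (symOp A₀ ψ).adjoint.graph)
    (hsymm : ∀ f g f' g', (f, g) ∈ N.graph → (f', g') ∈ N.graph → inner ℂ g f' = inner ℂ f g')
    (htrans : ∀ k ∈ defectSpan A₀ ψ, ∃ y, shiftInverse A₀ y + k ∈ N.domain) :
    ∃ R : Matrix (Fin n) (Fin n) ℂ, R.IsHermitian ∧ N = matrixOp A₀ ψ R := by
  have hval : ∀ y, ∀ k ∈ defectSpan A₀ ψ, shiftInverse A₀ y + k ∈ N.domain →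
      (shiftInverse A₀ y + k, y - (shiftInverse A₀ y + k)) ∈ N.graph := by
    intro y k hk hd
    obtain ⟨g, hg⟩ := LinearPMap.mem_domain_iff.1 hd
    have := (symOp A₀ ψ).adjoint.mem_graph_snd_inj (hadj _ _ hg) (h.mem_adjoint_graph y hk) rfl
    rwa [this] at hg
  -- Green's identity: the terms containing G cancel, so symmetry of N involves only the coordinates
  -- (y, k).
  have hsymm' : ∀ y, ∀ k ∈ defectSpan A₀ ψ, ∀ y', ∀ k' ∈ defectSpan A₀ ψ,
      shiftInverse A₀ y + k ∈ N.domain → shiftInverse A₀ y' + k' ∈ N.domain →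
        inner ℂ y k' = inner ℂ k y' := by
    intro y k hk y' k' hk' hd hd'
    have h1 := hsymm _ _ _ _ (hval y k hk hd) (hval y' k' hk' hd')
    simp only [inner_sub_left, inner_sub_right, inner_add_left, inner_add_right,
      shiftInverse_symm h.selfAdjoint h.nonneg] at h1
    linear_combination h1
  choose y hy using fun j => htrans (defectVec A₀ ψ j) (defectVec_mem j)
  have hcomb : ∀ α : Fin n → ℂ, shiftInverse A₀ (∑ j, α j • y j) +
      ∑ j, α j • defectVec A₀ ψ j ∈ N.domain := by
    intro α
    have : shiftInverse A₀ (∑ j, α j • y j) + ∑ j, α j • defectVec A₀ ψ j =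
        ∑ j, α j • (shiftInverse A₀ (y j) + defectVec A₀ ψ j) := by
      simp [Finset.sum_add_distrib]
    rw [this]
    exact Submodule.sum_mem _ fun j _ => Submodule.smul_mem _ _ (hy j)
  -- The sign is forced by requiring G y_j + h_j to satisfy the boundary conditions of R. Green's
  -- identity makes R Hermitian.
  obtain ⟨R, hRy⟩ : ∃ R : Matrix (Fin n) (Fin n) ℂ,
      ∀ i j, R i j = -inner ℂ (defectVec A₀ ψ i) (y j) := ⟨Matrix.of _, fun i j => rfl⟩
  refine ⟨R, ?_, ?_⟩
  · ext i j
    rw [Matrix.conjTranspose_apply, hRy, hRy, star_neg]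
    congr 1
    exact (inner_conj_symm _ _).trans
      (hsymm' _ _ (defectVec_mem i) _ _ (defectVec_mem j) (hy i) (hy j))
  · have hR : ∀ (α : Fin n → ℂ) (x : H) (i), inner ℂ (defectVec A₀ ψ i) x + ∑ p, R i p * α p =
        inner ℂ (defectVec A₀ ψ i) (x - ∑ j, α j • y j) := by
      intro α x i
      rw [inner_sub_right, inner_sum, sub_eq_add_neg, ← Finset.sum_neg_distrib]
      congr 1
      refine Finset.sum_congr rfl fun j _ => ?_
      rw [inner_smul_right, hRy]
      ring
    have hdiff : ∀ (x : H) (α : Fin n → ℂ),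
        shiftInverse A₀ x + ∑ p, α p • defectVec A₀ ψ p ∈ N.domain ↔
          shiftInverse A₀ (x - ∑ j, α j • y j) ∈ N.domain := by
      intro x α
      have : shiftInverse A₀ x + ∑ p, α p • defectVec A₀ ψ p =
          shiftInverse A₀ (x - ∑ j, α j • y j) +
            (shiftInverse A₀ (∑ j, α j • y j) + ∑ j, α j • defectVec A₀ ψ j) := by
        rw [map_sub]
        abel
      rw [this]
      exact Submodule.add_mem_iff_left _ (hcomb α)
    have hdom : ∀ (x : H) (α : Fin n → ℂ),
        shiftInverse A₀ x + ∑ p, α p • defectVec A₀ ψ p ∈ N.domain ↔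
        shiftInverse A₀ x + ∑ p, α p • defectVec A₀ ψ p ∈ (matrixOp A₀ ψ R).domain := by
      intro x α
      rw [h.mem_domain_matrixOp, hdiff]
      simp_rw [hR]
      -- With z = x - Σ α_j y_j, the claim is that G z ∈ D(N) exactly when z ⟂ 𝓗: one way by Green's
      -- identity against G y_i + h_i, the other because then G z ∈ D(A_sym).
      constructor
      · intro hd i
        rw [← add_zero (shiftInverse A₀ _)] at hd
        have h1 := hsymm' _ _ (defectVec_mem i) _ _ (zero_mem _) (hy i) hd
        rw [← h1, inner_zero_right]
      · intro hi
        exact hle.1 (LinearPMap.mem_domain_of_mem_graph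
          (h.symOp_graph.mem_graph (mem_defectSpan_orthogonal.2 hi)))
    have hrep : ∀ f g, (f, g) ∈ (symOp A₀ ψ).adjoint.graph →
        (f ∈ N.domain ↔ f ∈ (matrixOp A₀ ψ R).domain) := by
      intro f g hfg
      obtain ⟨α, hα⟩ := mem_defectSpan.1 (h.adjoint_graph.1 hfg)
      have := hdom (f + g) α
      rwa [hα, add_sub_cancel] at this
    refine LinearPMap.eq_of_eq_graph (Submodule.ext ?_)
    rintro ⟨f, g⟩
    constructor
    · intro hfg
      have hd := (hrep f g (hadj f g hfg)).1 (LinearPMap.mem_domain_of_mem_graph hfg)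
      obtain ⟨g', hg'⟩ := LinearPMap.mem_domain_iff.1 hd
      obtain rfl := (symOp A₀ ψ).adjoint.mem_graph_snd_inj (hadj f g hfg)
        (mem_graph_matrixOp.1 hg').2 rfl
      exact hg'
    · intro hfg
      have hfg' := (mem_graph_matrixOp.1 hfg).2
      have hd := (hrep f g hfg').2 (LinearPMap.mem_domain_of_mem_graph hfg)
      obtain ⟨g', hg'⟩ := LinearPMap.mem_domain_iff.1 hd
      obtain rfl := (symOp A₀ ψ).adjoint.mem_graph_snd_inj hfg' (hadj f g' hg') rfl
      exact hg'

/-- If in addition the elements of `D(N) ∩ 𝓗₁` lie in the form domain of `A_sym`, the matrix is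
admissible. -/
theorem IsSingularFamily.isAdmissible (h : IsSingularFamily A₀ ψ)
    {R : Matrix (Fin n) (Fin n) ℂ} (hR : R.IsHermitian)
    (hform : ∀ f ∈ (matrixOp A₀ ψ R).domain, f ∈ spaceOne A₀ → f ∈ formDomain (symOp A₀ ψ)) :
    IsAdmissibleMatrix A₀ ψ R := by
  refine ⟨hR, fun c hc => ?_⟩
  obtain ⟨a, ha⟩ := exists_sqrtShiftInverse_eq h.selfAdjoint h.nonneg hc
  refine ⟨mem_spaceOne.2 ⟨a, ha⟩, fun w hf => ?_⟩
  obtain ⟨z, hz⟩ := mem_spaceOne.1 hf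
  refine (congrArg₂ (inner ℂ) (sqrtShift_apply h.selfAdjoint h.nonneg _ ha)
    (sqrtShift_apply h.selfAdjoint h.nonneg _ hz)).trans ?_
  -- This y corrects the D(A₀)-component so that f = G x + f̃ with f̃ in the domain of the matrix
  -- operator. Then f̃ is in 𝓗₁ too, hence in the form domain, and (A₀ + I)^{1/2} f̃ is orthogonal
  -- to a ∈ L; only the G x term contributes.
  obtain ⟨y, hy⟩ := exists_inner_eq h.linearIndependent_defectVec fun i => -∑ p, R i p * w.2 p
  have hd : shiftInverse A₀ y + ∑ p, w.2 p • defectVec A₀ ψ p ∈ (matrixOp A₀ ψ R).domain :=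
    h.mem_domain_matrixOp.2 fun i => by rw [hy, neg_add_cancel]
  set x := shift A₀ w.1 - y with hx
  have h1 : assemble A₀ ψ w = shiftInverse A₀ x +
      (shiftInverse A₀ y + ∑ p, w.2 p • defectVec A₀ ψ p) := by
    rw [hx, map_sub, shiftInverse_shift h.selfAdjoint h.nonneg, assemble_apply]
    abel
  have h2 : sqrtShiftInverse A₀ (z - sqrtShiftInverse A₀ x) =
      shiftInverse A₀ y + ∑ p, w.2 p • defectVec A₀ ψ p := by
    rw [map_sub, hz, h1, sqrtShiftInverse_sq h.selfAdjoint h.nonneg, add_sub_cancel_left]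
  obtain ⟨z', hz', hz2⟩ := h.mem_formDomain.1 (hform _ hd (mem_spaceOne.2 ⟨_, h2⟩))
  have h3 := sqrtShiftInverse_injective h.selfAdjoint h.nonneg (hz2.trans h2.symm)
  have h4 : inner ℂ a z' = 0 := by
    refine hz' a ?_
    rw [mem_defectRoot, ha, extResolvent_sum]
    exact sum_smul_defectVec_mem c
  rw [h3, inner_sub_right, sub_eq_zero, ← sqrtShiftInverse_symm, ha, extResolvent_sum,
    sum_inner] at h4
  rw [h4]
  refine Finset.sum_congr rfl fun j _ => ?_
  rw [inner_smul_left, extFunctional_apply, hx, inner_sub_right, hy, sub_neg_eq_add]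

/-! ### The Krein-von Neumann extension of the intermediate operator -/

variable {K : Submodule ℂ H}

/-- `D(S_N) + D(A₀) = D(A_sym*)`. -/
theorem IsSingularFamily.exists_mem_domain_kreinVonNeumann (h : IsSingularFamily A₀ ψ)
    (hFN : Transversal (symOp A₀ ψ) (friedrichs (symOp A₀ ψ)) (kreinVonNeumann (symOp A₀ ψ)))
    (hK : K ≤ defectSpan A₀ ψ)
    (hdim : Module.finrank ℂ K = Module.finrank ℂ (defectSpan A₀ ψ ⊓ spaceOne A₀ : Submodule ℂ H))
    (hint : K ⊓ (defectSpan A₀ ψ ⊓ (defectSpan A₀ ψ ⊓ spaceOne A₀)ᗮ) = ⊥)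
    {k : H} (hk : k ∈ defectSpan A₀ ψ) :
    ∃ y, shiftInverse A₀ y + k ∈ (kreinVonNeumann (intermediateOp A₀ ψ K)).domain := by
  have hfd : FiniteDimensional ℂ (defectSpan A₀ ψ ⊓ spaceOne A₀ : Submodule ℂ H) :=
    Submodule.finiteDimensional_of_le inf_le_left
  have hfK : FiniteDimensional ℂ K := Submodule.finiteDimensional_of_le hK
  -- G - G_F maps K into 𝓗', injectively because K meets 𝓗'' trivially, and so bijectively by
  -- equality of dimensions.
  let T : K →ₗ[ℂ] (defectSpan A₀ ψ ⊓ spaceOne A₀ : Submodule ℂ H) :=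
    (((shiftInverse A₀ - friedrichsResolvent A₀ ψ : H →L[ℂ] H) : H →ₗ[ℂ] H).domRestrict K).codRestrict
      _ fun x => h.shiftInverse_sub_friedrichsResolvent_mem x
  have hT : Function.Injective T := by
    refine (injective_iff_map_eq_zero _).2 fun x hx => Subtype.ext ?_
    have h1 : shiftInverse A₀ (x : H) - friedrichsResolvent A₀ ψ x = 0 := congrArg Subtype.val hx
    have h2 := h.mem_orthogonal_of_shiftInverse_eq (sub_eq_zero.1 h1)
    exact (Submodule.eq_bot_iff _).1 hint x ⟨x.2, hK x.2, h2⟩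
  have hT' := (LinearMap.injective_iff_surjective_of_finrank_eq_finrank hdim).1 hT
  have hk' := hk
  rw [← sup_orthogonal_eq_of_finrank_eq inf_le_left hK hdim hint] at hk'
  obtain ⟨l, hl, m, hm, rfl⟩ := Submodule.mem_sup.1 hk'
  obtain ⟨y, f, g, rfl, hfg⟩ := h.exists_friedrichs_add_kreinVonNeumann hFN hm
  obtain ⟨x, hx⟩ := hT' (⟨l, hl⟩ - ⟨_, h.shiftInverse_sub_friedrichsResolvent_mem y⟩)
  have hx' : shiftInverse A₀ (x : H) - friedrichsResolvent A₀ ψ x =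
    l - (shiftInverse A₀ y - friedrichsResolvent A₀ ψ y) := congrArg Subtype.val hx
  -- By the choice of x all terms with G cancel, leaving f - G_F x with f ∈ D(S_N) and G_F x ∈ D(S).
  refine ⟨-(y + x), ?_⟩
  have h1 : shiftInverse A₀ (-(y + x)) + (l + (friedrichsResolvent A₀ ψ y + f)) =
      f - friedrichsResolvent A₀ ψ x := by
    rw [map_neg, map_add, ← sub_eq_zero]
    rw [← sub_eq_zero] at hx'
    rw [← neg_eq_zero, ← hx']
    abel
  rw [h1]
  refine sub_mem (LinearPMap.mem_domain_of_mem_graph hfg) ?_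
  refine (le_kreinVonNeumann h.dense_intermediateOp h.intermediateOp_isSymm).1
    (LinearPMap.mem_domain_of_mem_graph
      (h.intermediateOp_graph.mem_graph (Submodule.mem_sup_right x.2)))

/-- The vector f - G_F(f + g) lies in 𝓗 ∩ Kᗮ, and in 𝓗₁ when f does. It then belongs to 𝓗' ∩ Kᗮ = 0,
so f is in the range of G_F. -/
theorem IsSingularFamily.mem_formDomain_of_mem_spaceOne (h : IsSingularFamily A₀ ψ)
    (hK : K ≤ defectSpan A₀ ψ)
    (hdim : Module.finrank ℂ K = Module.finrank ℂ (defectSpan A₀ ψ ⊓ spaceOne A₀ : Submodule ℂ H))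
    (hint : K ⊓ (defectSpan A₀ ψ ⊓ (defectSpan A₀ ψ ⊓ spaceOne A₀)ᗮ) = ⊥) {f : H}
    (hf : f ∈ (kreinVonNeumann (intermediateOp A₀ ψ K)).domain) (hf' : f ∈ spaceOne A₀) :
    f ∈ formDomain (symOp A₀ ψ) := by
  obtain ⟨g, hg⟩ := LinearPMap.mem_domain_iff.1 hf
  have h1 := h.intermediateOp_adjoint_graph.1 (mem_graph_kreinVonNeumann.1 hg).1
  have h2 : friedrichsResolvent A₀ ψ (f + g) ∈ spaceOne A₀ := mem_spaceOne.2 ⟨_, rfl⟩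
  have h3 := (Submodule.eq_bot_iff _).1
    (inf_orthogonal_eq_bot_of_finrank_eq inf_le_left hK hdim hint) _
    ⟨⟨h1.1, sub_mem hf' h2⟩, h1.2⟩
  exact h.mem_formDomain.2 ⟨_, Submodule.starProjection_apply_mem _ _, (sub_eq_zero.1 h3).symm⟩

/-- The Krein-von Neumann extension of `S` is an admissible operator. -/
theorem IsSingularFamily.isAdmissible_kreinVonNeumann (h : IsSingularFamily A₀ ψ)
    (hFN : Transversal (symOp A₀ ψ) (friedrichs (symOp A₀ ψ)) (kreinVonNeumann (symOp A₀ ψ)))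
    (hK : K ≤ defectSpan A₀ ψ)
    (hdim : Module.finrank ℂ K = Module.finrank ℂ (defectSpan A₀ ψ ⊓ spaceOne A₀ : Submodule ℂ H))
    (hint : K ⊓ (defectSpan A₀ ψ ⊓ (defectSpan A₀ ψ ⊓ spaceOne A₀)ᗮ) = ⊥) :
    IsAdmissible A₀ ψ (kreinVonNeumann (intermediateOp A₀ ψ K)) := by
  obtain ⟨R, hR, hN⟩ := h.exists_eq_matrixOp
    (h.symOp_le.trans (le_kreinVonNeumann h.dense_intermediateOp h.intermediateOp_isSymm))
    (fun f g hfg => h.intermediateOp_adjoint_le (mem_graph_kreinVonNeumann.1 hfg).1)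
    (fun f g f' g' => kreinVonNeumann_symm h.dense_intermediateOp h.intermediateOp_nonneg
      h.intermediateOp_isSymm)
    (fun k hk => h.exists_mem_domain_kreinVonNeumann hFN hK hdim hint hk)
  refine ⟨R, h.isAdmissible hR fun f hf hf' => ?_, hN⟩
  rw [← hN] at hf
  exact h.mem_formDomain_of_mem_spaceOne hK hdim hint hf hf'

/-! ### Homogeneous operators determine their matrix -/

/-- Take f = G y + h_j in the domain of the operator. By homogeneity V f is there as well, and its
i-th boundary condition, written in coordinates, is the stated identity. -/
theorem IsSingularFamily.coeff_eq (h : IsSingularFamily A₀ ψ) {V : H ≃ₗᵢ[ℂ] H} {q : ℝ}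
    (hq : q ≠ 0) (hA : Intertwines V q A₀) {ξ : Fin n → ℝ}
    (hξ : ∀ j, extOperator A₀ V (ψ j) = (ξ j : ℂ) • ψ j) {R : Matrix (Fin n) (Fin n) ℂ}
    (hR : Intertwines V q (matrixOp A₀ ψ R)) (i j : Fin n) :
    R i j * (ξ i * ξ j - q) =
      ξ i * (1 - q) * inner ℂ (defectVec A₀ ψ i) (V (defectVec A₀ ψ j)) := by
  have hq' : (q : ℂ) ≠ 0 := by exact_mod_cast hq
  have hV : ∀ k, (ξ k : ℂ) • defectVec A₀ ψ k = (q : ℂ) • V (defectVec A₀ ψ k) +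
      (1 - q : ℂ) • shiftInverse A₀ (V (defectVec A₀ ψ k)) := by
    intro k
    have h1 := hA.extResolvent_extOperator h.selfAdjoint h.nonneg hq (ψ k)
    rwa [hξ, map_smul] at h1
  obtain ⟨y, hy⟩ := exists_inner_eq h.linearIndependent_defectVec fun i => -R i j
  set G := shiftInverse A₀
  set v := defectVec A₀ ψ
  set y' := V (G y) + ((q⁻¹ : ℝ) : ℂ) • V (y - G y) with hy'
  have hGy' : G y' = V (G y) := (mem_graph_iff_shiftInverse h.selfAdjoint h.nonneg).1
    ((hA _ _).1 (shiftInverse_mem_graph h.selfAdjoint h.nonneg y))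
  have hqy' : (q : ℂ) • y' + (1 - q : ℂ) • V (G y) = V y := by
    rw [hy', smul_add, smul_smul, Complex.ofReal_inv, mul_inv_cancel₀ hq', map_sub]
    module
  -- Here y' = (A₀ + I) V G y, and this is ⟨𝕌ψ_i, V u⟩ = ⟨ψ_i, u⟩ for u = G y, with 𝕌 the extension
  -- of V and 𝕌ψ_i = ξ_i ψ_i.
  have hξy : (ξ i : ℂ) * inner ℂ (v i) y' = -R i j := by
    have h1 : inner ℂ ((ξ i : ℂ) • v i) y' = (ξ i : ℂ) * inner ℂ (v i) y' := by
      rw [inner_smul_left, Complex.conj_ofReal]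
    rw [← h1, hV, inner_add_left, inner_smul_left, inner_smul_left,
      shiftInverse_symm h.selfAdjoint h.nonneg, hGy', ← hy, ← V.inner_map_map (v i) y, ← hqy',
      inner_add_right (V (v i)) ((q : ℂ) • y'), inner_smul_right, inner_smul_right]
    simp
  have hd : G y + ∑ p, (Pi.single j 1 : Fin n → ℂ) p • v p ∈ (matrixOp A₀ ψ R).domain := by
    refine h.mem_domain_matrixOp.2 fun i => ?_
    rw [hy]
    simp [Pi.single_apply]
  obtain ⟨g, hg⟩ := LinearPMap.mem_domain_iff.1 hd
  have hd' := LinearPMap.mem_domain_of_mem_graph ((hR _ _).1 hg)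
  have hVf : V (G y + ∑ p, (Pi.single j 1 : Fin n → ℂ) p • v p) =
      G (y' - ((1 - q) / q : ℂ) • V (v j)) +
        ∑ p, (Pi.single j (ξ j / q : ℂ) : Fin n → ℂ) p • v p := by
    have h1 : V (v j) = (ξ j / q : ℂ) • v j - ((1 - q) / q : ℂ) • G (V (v j)) := by
      have h2 := congrArg (fun z => (q : ℂ)⁻¹ • z) (hV j)
      simp only [smul_add, smul_smul, inv_mul_cancel₀ hq', one_smul] at h2
      rw [div_eq_inv_mul, div_eq_inv_mul, h2, add_sub_cancel_right]
    simp only [Pi.single_apply, ite_smul, one_smul, zero_smul, Finset.sum_ite_eq',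
      Finset.mem_univ, if_true]
    rw [map_add, map_sub, hGy', map_smul]
    nth_rewrite 1 [h1]
    abel
  rw [hVf] at hd'
  have h3 := h.mem_domain_matrixOp.1 hd' i
  simp only [Pi.single_apply, mul_ite, mul_zero, Finset.sum_ite_eq', Finset.mem_univ,
    if_true] at h3
  change inner ℂ (v i) _ + _ = 0 at h3
  rw [inner_sub_right, inner_smul_right] at h3
  have h4 : (q : ℂ) * (ξ i * (inner ℂ (v i) y' - (1 - q) / q * inner ℂ (v i) (V (v j)) +
      R i j * (ξ j / q))) = 0 := by rw [h3, mul_zero, mul_zero]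
  field_simp at h4
  linear_combination h4 - q * hξy

end Family

end SingPert

/-! ### Existence and uniqueness of the homogeneous admissible operator. -/

theorem mainTheorem6 {H : Type*} [NormedAddCommGroup H] [InnerProductSpace ℂ H] [CompleteSpace H]
    -- the unperturbed nonnegative self-adjoint operator
    (A₀ : H →ₗ.[ℂ] H) (hA₀ : IsSelfAdjoint A₀) (hA₀_nonneg : SingPert.IsNonneg A₀)
    -- the singular elements: linearly independent, with linear span meeting `H` only in `0`
    (n : ℕ) (ψ : Fin n → SingPert.MinusTwo A₀) (hψ : LinearIndependent ℂ ψ)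
    (hψ_sing : Disjoint (Submodule.span ℂ (Set.range ψ)) (LinearMap.range (SingPert.incl A₀)))
    -- the family of unitary operators, closed under adjoints
    (𝔗 : Set ℝ) (U : 𝔗 → (H ≃ₗᵢ[ℂ] H))
    (hU : ∀ V : H ≃ₗᵢ[ℂ] H, V ∈ Set.range U ↔ V.symm ∈ Set.range U)
    -- the symmetry of `A₀` and of the singular elements
    (p : 𝔗 → ℝ) (hp : SingPert.IsHomogeneous U p A₀)
    (ξ : Fin n → 𝔗 → ℝ) (hξ : ∀ j, SingPert.IsInvariant A₀ U (ξ j) (ψ j))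
    -- the Friedrichs and the Krein-von Neumann extension of `A_sym` are transversal
    (hFN : SingPert.Transversal (SingPert.symOp A₀ ψ)
      (SingPert.friedrichs (SingPert.symOp A₀ ψ)) (SingPert.kreinVonNeumann (SingPert.symOp A₀ ψ)))
    -- a choice of the subspace of the defect subspace for which `S` is `p(t)`-homogeneous
    (K : Submodule ℂ H) (hK : K ≤ SingPert.defect A₀ ψ)
    (hK_dim : Module.finrank ℂ K = Module.finrank ℂ (SingPert.defect' A₀ ψ))
    (hK_inter : K ⊓ SingPert.defect'' A₀ ψ = ⊥)
    (hS : SingPert.IsHomogeneous U p (SingPert.intermediateOp A₀ ψ K))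
    -- every `β_ij` is nonzero at some point
    (hβ : ∀ i j : Fin n, ∃ t : 𝔗, ξ i t - p t / ξ j t ≠ 0) :
    (∃! B : H →ₗ.[ℂ] H, SingPert.IsAdmissible A₀ ψ B ∧ SingPert.IsHomogeneous U p B) ∧
      SingPert.IsAdmissible A₀ ψ (SingPert.kreinVonNeumann (SingPert.intermediateOp A₀ ψ K)) ∧
      SingPert.IsHomogeneous U p (SingPert.kreinVonNeumann (SingPert.intermediateOp A₀ ψ K)) := by
  have h : SingPert.IsSingularFamily A₀ ψ := ⟨hA₀, hA₀_nonneg, hψ, hψ_sing⟩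
  rw [SingPert.defect'', SingPert.defect', h.defect_eq] at hK_inter
  rw [SingPert.defect', h.defect_eq] at hK_dim
  rw [h.defect_eq] at hK
  have hadm := h.isAdmissible_kreinVonNeumann hFN hK hK_dim hK_inter
  have hle : SingPert.intermediateOp A₀ ψ K ≤
      SingPert.kreinVonNeumann (SingPert.intermediateOp A₀ ψ K) :=
    SingPert.le_kreinVonNeumann h.dense_intermediateOp h.intermediateOp_isSymm
  have hhom : SingPert.IsHomogeneous U p
      (SingPert.kreinVonNeumann (SingPert.intermediateOp A₀ ψ K)) := by
    refine SingPert.isHomogeneous_of_intertwines ?_ (fun t => (hp.intertwines t).1) fun t =>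
      (hS.intertwines t).2.kreinVonNeumann (hp.intertwines t).1 h.dense_intermediateOp
    obtain ⟨x, hx⟩ := hS.ne_zero
    exact ⟨⟨x, hle.1 x.2⟩, by rwa [← hle.2 (x := x) rfl]⟩
  refine ⟨⟨_, ⟨hadm, hhom⟩, ?_⟩, hadm, hhom⟩
  rintro B ⟨⟨R, -, rfl⟩, hB⟩
  obtain ⟨R', -, hR'⟩ := hadm
  rw [hR'] at hhom ⊢
  congr 1
  ext i j
  obtain ⟨t, ht⟩ := hβ i j
  obtain ⟨hpt, hAt⟩ := hp.intertwines t
  have hξt : (ξ i t : ℂ) * ξ j t - p t ≠ 0 := by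
    have : ξ i t * ξ j t - p t ≠ 0 := by
      intro h0
      -- Division by zero gives 0 in Lean, so β_ij alone says nothing about ξ_j; but ξ_j = 0 would
      -- turn the vanishing factor into -p(t), which is nonzero.
      have hj : ξ j t ≠ 0 := by
        intro hj
        rw [hj, mul_zero, zero_sub, neg_eq_zero] at h0
        exact hpt h0
      apply ht
      field_simp
      linear_combination h0
    exact_mod_cast this
  refine mul_right_cancel₀ hξt ?_
  rw [h.coeff_eq hpt hAt (ξ := fun j => ξ j t) (fun j => hξ j t) (hB.intertwines t).2 i j,
    h.coeff_eq hpt hAt (ξ := fun j => ξ j t) (fun j => hξ j t) (hhom.intertwines t).2 i j]
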